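/- Let $A=(a_{ij})_{1\le i,j\le n}$ be a generalized Cartan matrix ($a_{ii}=2$, $a_{ij}\in\mathbb Z_{\le 0}$ for $i\ne j$, $a_{ij}\neq 0\iff a_{ji}\ne 0$) with symmetrizer $D=\mathrm{diag}(d_1,\dots,d_n)$, i.e. the $d_i$ are positive integers with $d_ia_{ij}=d_ja_{ji}$, and assume that $d_1,\dots,d_n$ are relatively prime, $\gcd(d_1,\dots,d_n)=1$. Put $I=\{1,\dots,n\}$. **Positive Yangian.** $Y^+_\hbar(\mathfrak g_{A,D})$ is the associative unital $\mathbb Q[\hbar]$-algebra with generators $x_{k,r}$ ($k\in I$, $r\in\mathbb N$) and relations, for all $k,l\in I$ and $r,s\ge 0$, $$x_{k,r+1}x_{l,s}-x_{k,r}x_{l,s+1}-\tfrac{d_ka_{kl}\hbar}{2}x_{k,r}x_{l,s}=x_{l,s}x_{k,r+1}-x_{l,s+1}x_{k,r}+\tfrac{d_ka_{kl}\hbar}{2}x_{l,s}x_{k,r},$$ and, for all $k\neq l$ with $N=1-a_{kl}$ and all $r_1,\dots,r_N,s\ge0$, $$\sum_{\sigma\in\mathfrak S_N}[x_{k,r_{\sigma(1)}},[x_{k,r_{\sigma(2)}},\dots,[x_{k,r_{\sigma(N)}},x_{l,s}]\dots]]=0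 .$$ **Quiver and weights.** Let $Q$ be the quiver with vertex set $I$ and, for each $i<j$, $m_{ij}=\gcd(a_{ij},a_{ji})$ arrows $h_1,\dots,h_{m_{ij}}$ from $i$ to $j$ (none if $a_{ij}=0$); write $\mathrm{out}(h)=i$, $\mathrm{in}(h)=j$, and let $H$ be the set of all arrows. If $m_{ij}\neq0$ put $l_{ij}=|a_{ij}|/m_{ij}$, $l_{ji}=|a_{ji}|/m_{ij}$ and $e_{ij}=d_il_{ij}=d_jl_{ji}$. The weights are $\mathbf m_i=d_i$, $\mathbf m_{h_p}=(m_{ij}+2-2p)e_{ij}$, $\mathbf m_{h_p^*}=(-m_{ij}+2p)e_{ij}$. **Shuffle algebra.** Specialize $t_1=t_2=\hbar/2$, $t_3=-\hbar$. For $v\in\mathbb N^I$ let $\mathcal{SH}_v=\mathbb C[\hbar][\lambda^i_s : i\in I,\,1\le s\le v^i]^{\prod_i\mathfrak S_{v^i}}$. The sign-twisted shuffle algebra is $\widetilde{\mathcal{SH}}=\bigoplus_v\mathcal{SH}_v$ with the product which for $f_1\in\mathcal{SH}_{v_1}$, $f_2\in\mathcal{SH}_{v_2}$ is $$f_1\star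 f_2=(-1)^{\sum_{h\in H}v_1^{\mathrm{in}(h)}v_2^{\mathrm{out}(h)}}\sum_{\sigma\in \mathrm{Sh}(v_1,v_2)}\sigma\big(f_1(\lambda')f_2(\lambda'')\,\mathrm{fac}_1\,\mathrm{fac}_2\big)\in\mathcal{SH}_{v_1+v_2},$$ where $\lambda'^i_s=\lambda^i_s$, $\lambda''^i_t=\lambda^i_{v_1^i+t}$, $\mathrm{Sh}(v_1,v_2)=\prod_i\mathrm{Sh}(v_1^i,v_2^i)$ is the set of shuffles (permutations that are increasing on the first $v_1^i$ and on the last $v_2^i$ indices for each $i$), $\sigma(\lambda^i_s)=\lambda^i_{\sigma_i(s)}$, and $$\mathrm{fac}_1=\prod_{i\in I}\prod_{s=1}^{v_1^i}\prod_{t=1}^{v_2^i}\frac{\lambda''^i_t-\lambda'^i_s+\mathbf m_it_3}{\lambda''^i_t-\lambda'^i_s},$$ $$\mathrm{fac}_2=\prod_{h\in H}\Big(\prod_{s=1}^{v_1^{\mathrm{out}(h)}}\prod_{t=1}^{v_2^{\mathrm{in}(h)}}\big(\lambda''^{\mathrm{in}(h)}_t-\lambda'^{\mathrm{out}(h)}_s+\mathbf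 m_ht_1\big)\prod_{s=1}^{v_1^{\mathrm{in}(h)}}\prod_{t=1}^{v_2^{\mathrm{out}(h)}}\big(\lambda''^{\mathrm{out}(h)}_t-\lambda'^{\mathrm{in}(h)}_s+\mathbf m_{h^*}t_2\big)\Big).$$ This is an associative unital $\mathbb C[\hbar]$-algebra. **Theorem.** The assignment $x_{k,r}\mapsto(\lambda^{(k)})^r\in\mathcal{SH}_{e_k}=\mathbb C[\hbar][\lambda^{(k)}]$, where $e_k$ is the $k$-th standard basis vector of $\mathbb N^I$ and $\lambda^{(k)}=\lambda^k_1$, extends to a (necessarily unique) homomorphism of $\mathbb Q[\hbar]$-algebras $Y^+_\hbar(\mathfrak g_{A,D})\to\widetilde{\mathcal{SH}}$. -/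

import Mathlib

open MvPolynomial

set_option linter.unusedSectionVars false
set_option linter.unusedSimpArgs false

namespace ShuffleYangian

noncomputable section

/-- A finite quiver with vertex set `I`, together with the integers `l i j` of a symmetrizer
(only the values at adjacent vertices matter). An arrow `h` goes from `out h` to `inc h`. -/
structure QuiverWithSymmetrizer (I : Type*) where
  Arrow : Type
  [fintypeArrow : Fintype Arrow]
  out : Arrow → I
  inc : Arrow → I
  l : I → I → ℕ

attribute [instance] QuiverWithSymmetrizer.fintypeArrow

/-- A weight function `I ⊔ H ⊔ Hᵒᵖ → ℤ`. -/
structure WeightFunction {I : Type*} (Q : QuiverWithSymmetrizer I) where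
  vertex : I → ℤ
  arrow : Q.Arrow → ℤ
  opArrow : Q.Arrow → ℤ

/-- The data defining a shuffle algebra over `R`: a quiver with symmetrizer, a weight function and
the (specialized) equivariant parameters `t₁, t₂, t₃ ∈ R`. -/
structure ShuffleDatum (I R : Type*) where
  quiver : QuiverWithSymmetrizer I
  weight : WeightFunction quiver
  t₁ : R
  t₂ : R
  t₃ : R

/-- The variables `λ^i_s`, `i ∈ I`, `1 ≤ s ≤ v^i` (indexed from `0` here). -/
abbrev Var {I : Type*} (v : I → ℕ) : Type _ := Σ i, Fin (v i)

section Setup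

variable {I : Type*} {R : Type*} [CommRing R]

/-- The action of `𝔖_v = ∏ i, 𝔖_{v^i}` on the variables. -/
def permVar {v : I → ℕ} (σ : ∀ i, Equiv.Perm (Fin (v i))) : Equiv.Perm (Var v) :=
  Equiv.sigmaCongrRight σ

/-- The degree `v` piece `R[λ^i_s]^{𝔖_v}` of the shuffle algebra. -/
def SHDeg (R : Type*) [CommRing R] (v : I → ℕ) : Subalgebra R (MvPolynomial (Var v) R) where
  carrier := {p | ∀ σ : ∀ i, Equiv.Perm (Fin (v i)), rename (permVar σ) p = p}
  mul_mem' := by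
    intro a b ha hb σ
    rw [map_mul, ha σ, hb σ]
  add_mem' := by
    intro a b ha hb σ
    rw [map_add, ha σ, hb σ]
  algebraMap_mem' := by
    intro r σ
    exact AlgHom.commutes _ r

/-- The position of the variable `λ'^i_s` of the first factor among the variables of degree
`v₁ + v₂`. -/
def inlVar (v₁ v₂ : I → ℕ) (a : Var v₁) : Var (v₁ + v₂) := ⟨a.1, Fin.castAdd (v₂ a.1) a.2⟩

/-- The position of the variable `λ''^i_t` of the second factor among the variables of degree
`v₁ + v₂`. -/
def inrVar (v₁ v₂ : I → ℕ) (b : Var v₂) : Var (v₁ + v₂) := ⟨b.1, Fin.natAdd (v₁ b.1) b.2⟩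

open Classical in
/-- The set `Sh(v₁, v₂) = ∏ i, Sh(v₁^i, v₂^i)` of shuffles. -/
def shuffles [Fintype I] (v₁ v₂ : I → ℕ) : Finset (∀ i, Equiv.Perm (Fin ((v₁ + v₂) i))) :=
  Finset.univ.filter fun σ => ∀ i,
    StrictMono (fun s : Fin (v₁ i) => σ i (Fin.castAdd (v₂ i) s)) ∧
    StrictMono (fun t : Fin (v₂ i) => σ i (Fin.natAdd (v₁ i) t))

variable (S : ShuffleDatum I R) {K : Type*} [Field K] [Algebra R K] {v₁ v₂ : I → ℕ}

/-- The factor `fac₁`, with `λ' = x` and `λ'' = y`. -/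
def fac₁ [Fintype I] (x : Var v₁ → K) (y : Var v₂ → K) : K :=
  ∏ i, ∏ s : Fin (v₁ i), ∏ t : Fin (v₂ i),
    (y ⟨i, t⟩ - x ⟨i, s⟩ + algebraMap R K (S.weight.vertex i * S.t₃)) / (y ⟨i, t⟩ - x ⟨i, s⟩)

/-- The factor `fac₂`, with `λ' = x` and `λ'' = y`. -/
def fac₂ (x : Var v₁ → K) (y : Var v₂ → K) : K :=
  ∏ h : S.quiver.Arrow,
    ((∏ s : Fin (v₁ (S.quiver.out h)), ∏ t : Fin (v₂ (S.quiver.inc h)),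
        (y ⟨S.quiver.inc h, t⟩ - x ⟨S.quiver.out h, s⟩
          + algebraMap R K (S.weight.arrow h * S.t₁))) *
      ∏ s : Fin (v₁ (S.quiver.inc h)), ∏ t : Fin (v₂ (S.quiver.out h)),
        (y ⟨S.quiver.out h, t⟩ - x ⟨S.quiver.inc h, s⟩
          + algebraMap R K (S.weight.opArrow h * S.t₂)))

/-- The value at the point `λ = x` of `∑_{σ ∈ Sh(v₁,v₂)} σ(f · g · fac₁ · fac₂)`, where
`σ(λ^i_s) = λ^i_{σ(s)}`. -/
def shuffleSum [Fintype I] (f : MvPolynomial (Var v₁) R) (g : MvPolynomial (Var v₂) R)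
    (x : Var (v₁ + v₂) → K) : K :=
  ∑ σ ∈ shuffles v₁ v₂,
    aeval (fun a => x (permVar σ (inlVar v₁ v₂ a))) f *
    aeval (fun b => x (permVar σ (inrVar v₁ v₂ b))) g *
    fac₁ S (fun a => x (permVar σ (inlVar v₁ v₂ a))) (fun b => x (permVar σ (inrVar v₁ v₂ b))) *
    fac₂ S (fun a => x (permVar σ (inlVar v₁ v₂ a))) (fun b => x (permVar σ (inrVar v₁ v₂ b)))

/-- The field of rational functions in the variables of degree `v`. -/
abbrev RatFun (R : Type*) [CommRing R] (v : I → ℕ) : Type _ :=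
  FractionRing (MvPolynomial (Var v) R)

/-- The variable `λ^i_s` as a rational function. -/
def lam (R : Type*) [CommRing R] {v : I → ℕ} (a : Var v) : RatFun R v :=
  algebraMap (MvPolynomial (Var v) R) (RatFun R v) (X a)

/-- The exponent `∑_{h ∈ H} v₁^{inc h} v₂^{out h}` of the sign twist. -/
def signExp (v₁ v₂ : I → ℕ) : ℕ :=
  ∑ h : S.quiver.Arrow, v₁ (S.quiver.inc h) * v₂ (S.quiver.out h)

end Setup

/-! ### The shuffle product is a symmetric polynomial -/

section Polynomiality

section Divisibility

variable {V R : Type*} [CommRing R]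

open Classical in
lemma sub_dvd_iff (u w : V) (Q : MvPolynomial V R) :
    (X w - X u : MvPolynomial V R) ∣ Q ↔ rename (Function.update id u w) Q = 0 := by
  constructor
  · rintro ⟨c, rfl⟩
    rw [map_mul, map_sub, rename_X, rename_X]
    by_cases h : w = u
    · subst h; simp
    · simp [Function.update_of_ne h]
  · intro h
    rw [← Ideal.mem_span_singleton, ← Ideal.Quotient.eq_zero_iff_mem]
    have key : (Ideal.Quotient.mkₐ R (Ideal.span {(X w - X u : MvPolynomial V R)})).comp
        (rename (Function.update id u w)) = Ideal.Quotient.mkₐ R _ := by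
      apply MvPolynomial.algHom_ext
      intro i
      simp only [AlgHom.comp_apply, rename_X]
      by_cases hi : i = u
      · subst hi
        simp only [Function.update_self, Ideal.Quotient.mkₐ_eq_mk]
        rw [Ideal.Quotient.eq]
        exact Ideal.mem_span_singleton_self _
      · simp [Function.update_of_ne hi]
    have := congrArg (fun φ => φ Q) key
    simp only [AlgHom.comp_apply, h, map_zero, Ideal.Quotient.mkₐ_eq_mk] at this
    exact this.symm

lemma sub_prime [IsDomain R] {u w : V} (h : u ≠ w) : Prime (X w - X u : MvPolynomial V R) := by
  classical
  refine ⟨?_, ?_, ?_⟩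
  · rw [sub_ne_zero]
    exact fun e => h (MvPolynomial.X_injective e).symm
  · intro hu
    have := (sub_dvd_iff (R := R) u w 1).1 hu.dvd
    simp at this
  · intro a b hab
    rw [sub_dvd_iff, map_mul, mul_eq_zero] at hab
    rwa [sub_dvd_iff, sub_dvd_iff]

lemma sub_not_dvd [IsDomain R] {u w u' w' : V} (h : u' ≠ w') (h1 : ¬ (u' = u ∧ w' = w))
    (h2 : ¬ (u' = w ∧ w' = u)) :
    ¬ (X w - X u : MvPolynomial V R) ∣ X w' - X u' := by
  classical
  rw [sub_dvd_iff, map_sub, rename_X, rename_X, sub_eq_zero]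
  intro e
  have e := MvPolynomial.X_injective e
  simp only [Function.update_apply, id] at e
  split_ifs at e <;> grind

lemma prod_sub_dvd [IsDomain R] {ι : Type*} (s : Finset ι) (u w : ι → V)
    (hne : ∀ a ∈ s, u a ≠ w a)
    (h1 : ∀ a ∈ s, ∀ b ∈ s, a ≠ b → ¬ (u a = u b ∧ w a = w b))
    (h2 : ∀ a ∈ s, ∀ b ∈ s, a ≠ b → ¬ (u a = w b ∧ w a = u b))
    (Q : MvPolynomial V R) (hQ : ∀ a ∈ s, (X (w a) - X (u a) : MvPolynomial V R) ∣ Q) :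
    (∏ a ∈ s, (X (w a) - X (u a) : MvPolynomial V R)) ∣ Q := by
  classical
  induction s using Finset.induction_on with
  | empty => simp
  | insert a s ha ih =>
    obtain ⟨c, hc⟩ := ih (fun b hb => hne b (Finset.mem_insert_of_mem hb))
      (fun b hb c hc => h1 b (Finset.mem_insert_of_mem hb) c (Finset.mem_insert_of_mem hc))
      (fun b hb c hc => h2 b (Finset.mem_insert_of_mem hb) c (Finset.mem_insert_of_mem hc))
      (fun b hb => hQ b (Finset.mem_insert_of_mem hb))
    have hp := sub_prime (R := R) (hne a (Finset.mem_insert_self a s))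
    have hd := hQ a (Finset.mem_insert_self a s)
    rw [hc] at hd
    have hnd : ¬ (X (w a) - X (u a) : MvPolynomial V R) ∣
        ∏ b ∈ s, (X (w b) - X (u b) : MvPolynomial V R) := by
      rw [hp.dvd_finsetProd_iff]
      rintro ⟨b, hb, hdb⟩
      have hba : b ≠ a := fun e => ha (e ▸ hb)
      exact sub_not_dvd (hne b (Finset.mem_insert_of_mem hb))
        (h1 b (Finset.mem_insert_of_mem hb) a (Finset.mem_insert_self a s) hba)
        (h2 b (Finset.mem_insert_of_mem hb) a (Finset.mem_insert_self a s) hba) hdb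
    obtain ⟨e, he⟩ := (hp.dvd_or_dvd hd).resolve_left hnd
    rw [Finset.prod_insert ha, hc, he]
    exact ⟨e, by ring⟩

lemma sub_dvd_of_antisymm [IsDomain R] [CharZero R] {u w : V} {τ : V → V} (hu : τ u = w)
    (hw : τ w = u) (ho : ∀ a, a ≠ u → a ≠ w → τ a = a)
    {Q : MvPolynomial V R} (hQ : rename τ Q = -Q) :
    (X w - X u : MvPolynomial V R) ∣ Q := by
  classical
  rw [sub_dvd_iff]
  have h : rename (Function.update id u w) (rename τ Q)
      = rename (Function.update id u w) Q := by
    rw [rename_rename]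
    congr 2
    funext a
    simp only [Function.comp, Function.update_apply, id]
    grind
  rw [hQ, map_neg] at h
  exact self_eq_neg.1 h.symm

end Divisibility

variable {I : Type*} [Fintype I] {R : Type*} [CommRing R]
variable (S : ShuffleDatum I R) {K : Type*} [Field K] [Algebra R K] {v₁ v₂ : I → ℕ}

/-- Choices of the positions of the variables of the first factor. -/
def Sub (v₁ v₂ : I → ℕ) : Type _ :=
  {A : ∀ i, Finset (Fin ((v₁ + v₂) i)) // ∀ i, (A i).card = v₁ i}

instance : Finite (Sub v₁ v₂) := by unfold Sub; infer_instance

instance : Fintype (Sub v₁ v₂) := Fintype.ofFinite _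

lemma Sub.card_compl (A : Sub v₁ v₂) (i : I) : (A.1 i)ᶜ.card = v₂ i := by
  rw [Finset.card_compl, A.2 i, Fintype.card_fin, Pi.add_apply, Nat.add_sub_cancel_left]

def Sub.left (A : Sub v₁ v₂) (a : Var v₁) : Var (v₁ + v₂) :=
  ⟨a.1, (A.1 a.1).orderEmbOfFin (A.2 a.1) a.2⟩

def Sub.right (A : Sub v₁ v₂) (b : Var v₂) : Var (v₁ + v₂) :=
  ⟨b.1, (A.1 b.1)ᶜ.orderEmbOfFin (A.card_compl b.1) b.2⟩

lemma mem_shuffles {σ : ∀ i, Equiv.Perm (Fin ((v₁ + v₂) i))} : σ ∈ shuffles v₁ v₂ ↔ ∀ i,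
    StrictMono (fun s : Fin (v₁ i) => σ i (Fin.castAdd (v₂ i) s)) ∧
    StrictMono (fun t : Fin (v₂ i) => σ i (Fin.natAdd (v₁ i) t)) := by
  classical
  simp [shuffles]

/-- The subset attached to a shuffle. -/
def Sub.ofPerm (v₁ v₂ : I → ℕ) (σ : ∀ i, Equiv.Perm (Fin ((v₁ + v₂) i))) : Sub v₁ v₂ :=
  ⟨fun i => Finset.univ.map ⟨fun s : Fin (v₁ i) => σ i (Fin.castAdd (v₂ i) s),
      (σ i).injective.comp (Fin.castAdd_injective _ _)⟩, fun i => by simp⟩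

lemma Sub.left_ofPerm {σ : ∀ i, Equiv.Perm (Fin ((v₁ + v₂) i))} (hσ : σ ∈ shuffles v₁ v₂)
    (a : Var v₁) : (Sub.ofPerm v₁ v₂ σ).left a = permVar σ (inlVar v₁ v₂ a) := by
  obtain ⟨i, s⟩ := a
  have h := Finset.orderEmbOfFin_unique ((Sub.ofPerm v₁ v₂ σ).2 i)
    (f := fun s : Fin (v₁ i) => σ i (Fin.castAdd (v₂ i) s))
    (fun s => by simp [Sub.ofPerm]) (mem_shuffles.1 hσ i).1
  exact congrArg (Sigma.mk i) (congrFun h s).symm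

lemma Sub.right_ofPerm {σ : ∀ i, Equiv.Perm (Fin ((v₁ + v₂) i))} (hσ : σ ∈ shuffles v₁ v₂)
    (b : Var v₂) : (Sub.ofPerm v₁ v₂ σ).right b = permVar σ (inrVar v₁ v₂ b) := by
  obtain ⟨i, t⟩ := b
  have h := Finset.orderEmbOfFin_unique ((Sub.ofPerm v₁ v₂ σ).card_compl i)
    (f := fun t : Fin (v₂ i) => σ i (Fin.natAdd (v₁ i) t))
    (fun t => by
      simp only [Sub.ofPerm, Finset.mem_compl, Finset.mem_map, Finset.mem_univ, true_and,
        Function.Embedding.coeFn_mk, not_exists]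
      intro s hs
      have := congrArg Fin.val ((σ i).injective hs)
      simp at this
      omega) (mem_shuffles.1 hσ i).2
  exact congrArg (Sigma.mk i) (congrFun h t).symm

lemma Sub.exists_perm (A : Sub v₁ v₂) : ∃ σ ∈ shuffles v₁ v₂, Sub.ofPerm v₁ v₂ σ = A := by
  refine ⟨fun i => (finSumFinEquiv.symm.trans
    (finSumEquivOfFinset (A.2 i) (A.card_compl i)) :
      Fin (v₁ i + v₂ i) ≃ Fin ((v₁ + v₂) i)), ?_, ?_⟩
  · rw [mem_shuffles]
    intro i
    constructor
    · intro a b hab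
      simpa using hab
    · intro a b hab
      simpa using hab
  · apply Subtype.ext
    funext i
    ext a
    have h1 : ∀ s : Fin (v₁ i), (finSumEquivOfFinset (A.2 i) (A.card_compl i))
        (finSumFinEquiv.symm (Fin.castAdd (v₂ i) s)) = (A.1 i).orderEmbOfFin (A.2 i) s := by
      intro s
      rw [finSumFinEquiv_symm_apply_castAdd]
      rfl
    have h2 := Set.ext_iff.1 (Finset.range_orderEmbOfFin (A.1 i) (A.2 i)) a
    simp only [Set.mem_range, ← h1, Finset.mem_coe] at h2
    simpa [Sub.ofPerm] using h2

lemma Sub.ofPerm_injOn : Set.InjOn (Sub.ofPerm v₁ v₂) (shuffles v₁ v₂) := by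
  intro σ hσ τ hτ h
  funext i
  ext a
  have hl := fun s => (Sub.left_ofPerm hσ ⟨i, s⟩).symm.trans
    ((congrArg (fun A => Sub.left A ⟨i, s⟩) h).trans (Sub.left_ofPerm hτ ⟨i, s⟩))
  have hr := fun s => (Sub.right_ofPerm hσ ⟨i, s⟩).symm.trans
    ((congrArg (fun A => Sub.right A ⟨i, s⟩) h).trans (Sub.right_ofPerm hτ ⟨i, s⟩))
  simp only [permVar, inlVar, inrVar, Equiv.sigmaCongrRight_apply, Sigma.map, Sigma.mk.injEq,
    heq_eq_eq, true_and] at hl hr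
  refine congrArg Fin.val ?_
  refine Fin.addCases (motive := fun a => σ i a = τ i a) (fun s => hl s) (fun t => hr t) a

/-- The summand of the shuffle product attached to a choice of positions. -/
def subTerm (f : MvPolynomial (Var v₁) R) (g : MvPolynomial (Var v₂) R)
    (x : Var (v₁ + v₂) → K) (A : Sub v₁ v₂) : K :=
  aeval (fun a => x (A.left a)) f * aeval (fun b => x (A.right b)) g *
    fac₁ S (fun a => x (A.left a)) (fun b => x (A.right b)) *
    fac₂ S (fun a => x (A.left a)) (fun b => x (A.right b))

lemma shuffleSum_eq (f : MvPolynomial (Var v₁) R) (g : MvPolynomial (Var v₂) R)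
    (x : Var (v₁ + v₂) → K) :
    shuffleSum S f g x = ∑ A : Sub v₁ v₂, subTerm S f g x A := by
  refine Finset.sum_bij (fun σ _ => Sub.ofPerm v₁ v₂ σ) (fun _ _ => Finset.mem_univ _)
    (fun σ hσ τ hτ h => Sub.ofPerm_injOn hσ hτ h) (fun A _ => ?_) (fun σ hσ => ?_)
  · obtain ⟨σ, hσ, h⟩ := A.exists_perm
    exact ⟨σ, hσ, h⟩
  · simp only [subTerm, Sub.left_ofPerm hσ, Sub.right_ofPerm hσ]

lemma exists_perm_of_range {n : ℕ} {α : Type*} {a b : Fin n → α} (ha : Function.Injective a)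
    (hb : Function.Injective b) (h : Set.range a = Set.range b) :
    ∃ ρ : Equiv.Perm (Fin n), ∀ s, a s = b (ρ s) := by
  refine ⟨(Equiv.ofInjective a ha).trans ((Equiv.setCongr h).trans
    (Equiv.ofInjective b hb).symm), fun s => ?_⟩
  have := Equiv.apply_ofInjective_symm hb ((Equiv.setCongr h) (Equiv.ofInjective a ha s))
  simpa using this.symm

lemma aeval_perm {v : I → ℕ} {f : MvPolynomial (Var v) R} (hf : f ∈ SHDeg R v)
    (ρ : ∀ i, Equiv.Perm (Fin (v i))) (x : Var v → K) :
    aeval (fun a => x (permVar ρ a)) f = aeval x f := by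
  conv_rhs => rw [← hf ρ, aeval_rename]
  rfl

lemma fac₁_perm (ρ : ∀ i, Equiv.Perm (Fin (v₁ i))) (ρ' : ∀ i, Equiv.Perm (Fin (v₂ i)))
    (x : Var v₁ → K) (y : Var v₂ → K) :
    fac₁ S (fun a => x (permVar ρ a)) (fun b => y (permVar ρ' b)) = fac₁ S x y := by
  unfold fac₁
  refine Finset.prod_congr rfl fun i _ => ?_
  refine Fintype.prod_equiv (ρ i) _ _ fun s => ?_
  refine Fintype.prod_equiv (ρ' i) _ _ fun t => ?_
  rfl

lemma fac₂_perm (ρ : ∀ i, Equiv.Perm (Fin (v₁ i))) (ρ' : ∀ i, Equiv.Perm (Fin (v₂ i)))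
    (x : Var v₁ → K) (y : Var v₂ → K) :
    fac₂ S (fun a => x (permVar ρ a)) (fun b => y (permVar ρ' b)) = fac₂ S x y := by
  unfold fac₂
  refine Finset.prod_congr rfl fun h _ => ?_
  congr 1
  · refine Fintype.prod_equiv (ρ _) _ _ fun s => ?_
    refine Fintype.prod_equiv (ρ' _) _ _ fun t => ?_
    rfl
  · refine Fintype.prod_equiv (ρ _) _ _ fun s => ?_
    refine Fintype.prod_equiv (ρ' _) _ _ fun t => ?_
    rfl

/-- The action of `𝔖_v` on choices of positions. -/
def Sub.act (τ : ∀ i, Equiv.Perm (Fin ((v₁ + v₂) i))) : Equiv.Perm (Sub v₁ v₂) where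
  toFun A := ⟨fun i => (A.1 i).map (τ i).toEmbedding, fun i => by simp [A.2 i]⟩
  invFun A := ⟨fun i => (A.1 i).map (τ i).symm.toEmbedding, fun i => by simp [A.2 i]⟩
  left_inv A := by
    apply Subtype.ext; funext i; ext a; simp
  right_inv A := by
    apply Subtype.ext; funext i; ext a; simp

lemma Sub.left_act (τ : ∀ i, Equiv.Perm (Fin ((v₁ + v₂) i))) (A : Sub v₁ v₂) :
    ∃ ρ : ∀ i, Equiv.Perm (Fin (v₁ i)), ∀ a,
      permVar τ (A.left a) = (Sub.act τ A).left (permVar ρ a) := by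
  have : ∀ i, ∃ ρ : Equiv.Perm (Fin (v₁ i)), ∀ s, τ i ((A.1 i).orderEmbOfFin (A.2 i) s) =
      ((Sub.act τ A).1 i).orderEmbOfFin ((Sub.act τ A).2 i) (ρ s) := by
    intro i
    apply exists_perm_of_range
    · exact (τ i).injective.comp ((A.1 i).orderEmbOfFin (A.2 i)).injective
    · exact (RelEmbedding.injective _)
    · rw [Finset.range_orderEmbOfFin]
      change Set.range ((τ i) ∘ ((A.1 i).orderEmbOfFin (A.2 i))) = _
      rw [Set.range_comp, Finset.range_orderEmbOfFin]
      exact (Finset.coe_map (τ i).toEmbedding (A.1 i)).symm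
  choose ρ hρ using this
  exact ⟨ρ, fun a => congrArg (Sigma.mk a.1) (hρ a.1 a.2)⟩

lemma Sub.right_act (τ : ∀ i, Equiv.Perm (Fin ((v₁ + v₂) i))) (A : Sub v₁ v₂) :
    ∃ ρ : ∀ i, Equiv.Perm (Fin (v₂ i)), ∀ a,
      permVar τ (A.right a) = (Sub.act τ A).right (permVar ρ a) := by
  have : ∀ i, ∃ ρ : Equiv.Perm (Fin (v₂ i)),
      ∀ s, τ i ((A.1 i)ᶜ.orderEmbOfFin (A.card_compl i) s) =
      ((Sub.act τ A).1 i)ᶜ.orderEmbOfFin ((Sub.act τ A).card_compl i) (ρ s) := by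
    intro i
    apply exists_perm_of_range
    · exact (τ i).injective.comp (RelEmbedding.injective _)
    · exact (RelEmbedding.injective _)
    · rw [Finset.range_orderEmbOfFin]
      change Set.range ((τ i) ∘ ((A.1 i)ᶜ.orderEmbOfFin (A.card_compl i))) = _
      rw [Set.range_comp, Finset.range_orderEmbOfFin]
      rw [Finset.coe_compl, Finset.coe_compl, Set.image_compl_eq (τ i).bijective]
      exact congrArg compl (Finset.coe_map (τ i).toEmbedding (A.1 i)).symm
  choose ρ hρ using this
  exact ⟨ρ, fun a => congrArg (Sigma.mk a.1) (hρ a.1 a.2)⟩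

lemma shuffleSum_perm {f : MvPolynomial (Var v₁) R} {g : MvPolynomial (Var v₂) R}
    (hf : f ∈ SHDeg R v₁) (hg : g ∈ SHDeg R v₂) (x : Var (v₁ + v₂) → K)
    (τ : ∀ i, Equiv.Perm (Fin ((v₁ + v₂) i))) :
    shuffleSum S f g (fun a => x (permVar τ a)) = shuffleSum S f g x := by
  rw [shuffleSum_eq, shuffleSum_eq]
  refine Fintype.sum_equiv (Sub.act τ) _ _ fun A => ?_
  obtain ⟨ρ, hρ⟩ := Sub.left_act τ A
  obtain ⟨ρ', hρ'⟩ := Sub.right_act τ A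
  unfold subTerm
  simp only [hρ, hρ']
  rw [aeval_perm hf ρ (fun a => x ((Sub.act τ A).left a)),
    aeval_perm hg ρ' (fun a => x ((Sub.act τ A).right a)),
    fac₁_perm S ρ ρ' (fun a => x ((Sub.act τ A).left a)) (fun a => x ((Sub.act τ A).right a)),
    fac₂_perm S ρ ρ' (fun a => x ((Sub.act τ A).left a)) (fun a => x ((Sub.act τ A).right a))]

lemma map_shuffleSum {K' : Type*} [Field K'] [Algebra R K'] (ψ : K →ₐ[R] K')
    (f : MvPolynomial (Var v₁) R) (g : MvPolynomial (Var v₂) R) (x : Var (v₁ + v₂) → K) :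
    ψ (shuffleSum S f g x) = shuffleSum S f g (fun a => ψ (x a)) := by
  unfold shuffleSum fac₁ fac₂
  simp only [map_sum, map_mul, map_prod, map_div₀, map_add, map_sub, AlgHom.commutes,
    ← MvPolynomial.comp_aeval_apply]

/-- The Vandermonde polynomial of degree `v`. -/
def vdm (R : Type*) [CommRing R] (v : I → ℕ) : MvPolynomial (Var v) R :=
  ∏ i, (Matrix.vandermonde fun s : Fin (v i) => (X ⟨i, s⟩ : MvPolynomial (Var v) R)).det

lemma vdm_eq (v : I → ℕ) : vdm R v = ∏ p ∈ (Finset.univ : Finset I).sigma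
      (fun i => (Finset.univ : Finset (Fin (v i))).sigma fun s => Finset.Ioi s),
    (X (⟨p.1, p.2.2⟩ : Var v) - X (⟨p.1, p.2.1⟩ : Var v) : MvPolynomial (Var v) R) := by
  unfold vdm
  simp only [Matrix.det_vandermonde, Finset.prod_sigma]

lemma vdm_ne_zero [IsDomain R] (v : I → ℕ) : vdm R v ≠ 0 := by
  rw [vdm_eq, Finset.prod_ne_zero_iff]
  rintro ⟨i, s, t⟩ h
  simp only [Finset.mem_sigma, Finset.mem_univ, Finset.mem_Ioi, true_and] at h
  have hne : (⟨i, s⟩ : Var v) ≠ ⟨i, t⟩ := by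
    intro e
    simp at e
    exact h.ne e
  exact (sub_prime (R := R) hne).ne_zero

lemma vdm_dvd [IsDomain R] {v : I → ℕ} (Q : MvPolynomial (Var v) R)
    (hQ : ∀ (i : I) (s t : Fin (v i)), s < t →
      (X ⟨i, t⟩ - X ⟨i, s⟩ : MvPolynomial (Var v) R) ∣ Q) : vdm R v ∣ Q := by
  rw [vdm_eq]
  refine prod_sub_dvd (R := R) (V := Var v) (ι := Σ i, Σ _ : Fin (v i), Fin (v i))
    (Finset.univ.sigma (fun i => Finset.univ.sigma fun s => Finset.Ioi s))
    (fun p => (⟨p.1, p.2.1⟩ : Var v)) (fun p => (⟨p.1, p.2.2⟩ : Var v)) ?_ ?_ ?_ Q ?_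
  · rintro ⟨i, s, t⟩ h
    simp only [Finset.mem_sigma, Finset.mem_univ, Finset.mem_Ioi, true_and] at h
    intro e
    simp at e
    exact h.ne e
  · rintro ⟨i, s, t⟩ h ⟨i', s', t'⟩ h' hne ⟨e1, e2⟩
    simp only [Sigma.mk.injEq] at e1 e2
    obtain ⟨rfl, e1⟩ := e1
    obtain ⟨_, e2⟩ := e2
    simp only [heq_eq_eq] at e1 e2
    subst e1 e2
    exact hne rfl
  · rintro ⟨i, s, t⟩ h ⟨i', s', t'⟩ h' hne ⟨e1, e2⟩
    simp only [Sigma.mk.injEq] at e1 e2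
    obtain ⟨rfl, e1⟩ := e1
    obtain ⟨_, e2⟩ := e2
    simp only [heq_eq_eq] at e1 e2
    subst e1 e2
    simp only [Finset.mem_sigma, Finset.mem_univ, Finset.mem_Ioi, true_and] at h h'
    exact lt_asymm h h'
  · rintro ⟨i, s, t⟩ h
    simp only [Finset.mem_sigma, Finset.mem_univ, Finset.mem_Ioi, true_and] at h
    exact hQ i s t h

lemma sub_dvd_vdm {v : I → ℕ} (i : I) (s t : Fin (v i)) (h : s ≠ t) :
    (X ⟨i, t⟩ - X ⟨i, s⟩ : MvPolynomial (Var v) R) ∣ vdm R v := by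
  have key : ∀ s t : Fin (v i), s < t →
      (X ⟨i, t⟩ - X ⟨i, s⟩ : MvPolynomial (Var v) R) ∣ vdm R v := by
    intro s t hst
    let x : ∀ i, Fin (v i) → MvPolynomial (Var v) R := fun i s => X ⟨i, s⟩
    have h1 : (Matrix.vandermonde (x i)).det ∣ vdm R v :=
      Finset.dvd_prod_of_mem (fun i => (Matrix.vandermonde (x i)).det) (Finset.mem_univ i)
    have h2 : (∏ t ∈ Finset.Ioi s, (x i t - x i s)) ∣ (Matrix.vandermonde (x i)).det := by
      rw [Matrix.det_vandermonde]
      exact Finset.dvd_prod_of_mem (fun s => ∏ t ∈ Finset.Ioi s, (x i t - x i s))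
        (Finset.mem_univ s)
    have h3 : (x i t - x i s) ∣ ∏ t ∈ Finset.Ioi s, (x i t - x i s) :=
      Finset.dvd_prod_of_mem (fun t => x i t - x i s) (Finset.mem_Ioi.2 hst)
    exact h3.trans (h2.trans h1)
  rcases lt_or_gt_of_ne h with h | h
  · exact key s t h
  · rw [← neg_dvd, neg_sub]
    exact key t s h

lemma rename_vdm {v : I → ℕ} (τ : ∀ i, Equiv.Perm (Fin (v i))) :
    rename (permVar τ) (vdm R v) = (∏ i, ((Equiv.Perm.sign (τ i) : ℤ) : MvPolynomial (Var v) R))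
      * vdm R v := by
  unfold vdm
  rw [map_prod, ← Finset.prod_mul_distrib]
  refine Finset.prod_congr rfl fun i _ => ?_
  rw [← Matrix.det_permute, AlgHom.map_det]
  congr 1
  ext s t
  simp [Matrix.vandermonde, permVar, Sigma.map]

lemma subTerm_mul_vdm [IsDomain R] (f : MvPolynomial (Var v₁) R) (g : MvPolynomial (Var v₂) R)
    (A : Sub v₁ v₂) : ∃ Q : MvPolynomial (Var (v₁ + v₂)) R,
      subTerm S f g (lam R) A * algebraMap _ (RatFun R (v₁ + v₂)) (vdm R (v₁ + v₂))
        = algebraMap _ _ Q := by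
  have hlr : ∀ (i : I) (s : Fin (v₁ i)) (t : Fin (v₂ i)),
      (A.left ⟨i, s⟩).2 ≠ (A.right ⟨i, t⟩).2 := by
    intro i s t e
    have h1 := Finset.orderEmbOfFin_mem (A.1 i) (A.2 i) s
    have h2 := Finset.orderEmbOfFin_mem (A.1 i)ᶜ (A.card_compl i) t
    rw [Finset.mem_compl] at h2
    apply h2
    have e : (A.1 i).orderEmbOfFin (A.2 i) s = (A.1 i)ᶜ.orderEmbOfFin (A.card_compl i) t := e
    rwa [← e]
  set D : MvPolynomial (Var (v₁ + v₂)) R :=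
    ∏ i, ∏ s : Fin (v₁ i), ∏ t : Fin (v₂ i), (X (A.right ⟨i, t⟩) - X (A.left ⟨i, s⟩)) with hD
  have hDne : D ≠ 0 := by
    simp only [hD, Finset.prod_ne_zero_iff]
    intro i _ s _ t _
    have hne : A.left ⟨i, s⟩ ≠ A.right ⟨i, t⟩ := by
      intro e
      have := (Sigma.mk.inj_iff.1 e).2
      exact hlr i s t (eq_of_heq this)
    exact (sub_prime (R := R) hne).ne_zero
  have hDdvd : D ∣ vdm R (v₁ + v₂) := by
    have e : D = ∏ p ∈ (Finset.univ : Finset I).sigma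
      (fun i => (Finset.univ : Finset (Fin (v₁ i))) ×ˢ (Finset.univ : Finset (Fin (v₂ i)))),
        (X (A.right ⟨p.1, p.2.2⟩) - X (A.left ⟨p.1, p.2.1⟩)) := by
      rw [hD]
      simp only [Finset.prod_sigma, Finset.prod_product]
    rw [e]
    refine prod_sub_dvd (R := R) (V := Var (v₁ + v₂)) (ι := Σ i, Fin (v₁ i) × Fin (v₂ i))
      (Finset.univ.sigma fun _ => Finset.univ ×ˢ Finset.univ)
      (fun p => A.left ⟨p.1, p.2.1⟩) (fun p => A.right ⟨p.1, p.2.2⟩)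
      ?_ ?_ ?_ _ ?_
    · rintro ⟨i, s, t⟩ _ e
      exact hlr i s t (eq_of_heq (Sigma.mk.inj_iff.1 e).2)
    · rintro ⟨i, s, t⟩ _ ⟨i', s', t'⟩ _ hne ⟨e1, e2⟩
      obtain ⟨h1, e1⟩ := Sigma.mk.inj_iff.1 e1
      obtain ⟨_, e2⟩ := Sigma.mk.inj_iff.1 e2
      dsimp only at h1
      subst h1
      have e1 : s = s' := (RelEmbedding.injective _) (eq_of_heq e1)
      have e2 : t = t' := (RelEmbedding.injective _) (eq_of_heq e2)
      exact hne (by rw [e1, e2])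
    · rintro ⟨i, s, t⟩ _ ⟨i', s', t'⟩ _ hne ⟨e1, e2⟩
      obtain ⟨h1, e1⟩ := Sigma.mk.inj_iff.1 e1
      dsimp only at h1
      subst h1
      exact hlr i s t' (eq_of_heq e1)
    · rintro ⟨i, s, t⟩ _
      exact sub_dvd_vdm i _ _ (hlr i s t)
  obtain ⟨E, hE⟩ := hDdvd
  let ψ : MvPolynomial (Var (v₁ + v₂)) R →ₐ[R] RatFun R (v₁ + v₂) :=
    IsScalarTower.toAlgHom _ _ _
  have hψ : ∀ p, ψ p = algebraMap _ (RatFun R (v₁ + v₂)) p := fun _ => rfl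
  have hlam : ∀ a, lam R a = ψ (X a) := fun _ => rfl
  have hψ' : ψ = aeval (lam R) := by
    apply MvPolynomial.algHom_ext
    intro a
    rw [aeval_X, hlam]
  have hDne' : ψ D ≠ 0 := by
    rw [hψ]
    exact (map_ne_zero_iff _ (IsFractionRing.injective _ _)).2 hDne
  refine ⟨rename A.left f * rename A.right g *
    (∏ i, ∏ s : Fin (v₁ i), ∏ t : Fin (v₂ i),
      (X (A.right ⟨i, t⟩) - X (A.left ⟨i, s⟩) + algebraMap R _ (S.weight.vertex i * S.t₃))) *
    (∏ h : S.quiver.Arrow,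
    ((∏ s : Fin (v₁ (S.quiver.out h)), ∏ t : Fin (v₂ (S.quiver.inc h)),
        (X (A.right ⟨S.quiver.inc h, t⟩) - X (A.left ⟨S.quiver.out h, s⟩)
          + algebraMap R _ (S.weight.arrow h * S.t₁))) *
      ∏ s : Fin (v₁ (S.quiver.inc h)), ∏ t : Fin (v₂ (S.quiver.out h)),
        (X (A.right ⟨S.quiver.out h, t⟩) - X (A.left ⟨S.quiver.inc h, s⟩)
          + algebraMap R _ (S.weight.opArrow h * S.t₂)))) * E, ?_⟩
  have hf : aeval (fun a => lam R (A.left a)) f = ψ (rename A.left f) := by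
    rw [hψ', aeval_rename]
    rfl
  have hg : aeval (fun a => lam R (A.right a)) g = ψ (rename A.right g) := by
    rw [hψ', aeval_rename]
    rfl
  have gen : ∀ a b N F E D : RatFun R (v₁ + v₂), D ≠ 0 →
      a * b * (N / D) * F * (D * E) = a * b * N * F * E := by
    intro a b N F E D hD
    field_simp
  rw [hE, ← hψ, ← hψ]
  unfold subTerm
  rw [hf, hg]
  unfold fac₁ fac₂
  simp only [Finset.prod_div_distrib, hlam, ← map_sub, ← map_prod, ← hD]
  rw [map_mul ψ D E, gen _ _ _ _ _ _ hDne']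
  simp only [map_mul, map_prod, map_add, AlgHom.commutes]

theorem exists_shuffleProduct [IsDomain R] [CharZero R] (f : SHDeg R v₁) (g : SHDeg R v₂) :
    ∃ p : SHDeg R (v₁ + v₂), algebraMap _ (RatFun R (v₁ + v₂)) p.1
      = shuffleSum S f.1 g.1 (lam R) := by
  classical
  have hinj : Function.Injective (algebraMap (MvPolynomial (Var (v₁ + v₂)) R)
    (RatFun R (v₁ + v₂))) := IsFractionRing.injective _ _
  choose T hT using subTerm_mul_vdm S f.1 g.1
  set Q := ∑ A, T A with hQdef
  have hQ : shuffleSum S f.1 g.1 (lam R) * algebraMap _ (RatFun R (v₁ + v₂)) (vdm R (v₁ + v₂))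
      = algebraMap _ _ Q := by
    rw [shuffleSum_eq, Finset.sum_mul, hQdef, map_sum]
    exact Finset.sum_congr rfl fun A _ => hT A
  have hact : ∀ (τ : ∀ i, Equiv.Perm (Fin ((v₁ + v₂) i))) (p q : MvPolynomial (Var (v₁ + v₂)) R),
      shuffleSum S f.1 g.1 (lam R) * algebraMap _ (RatFun R (v₁ + v₂)) p = algebraMap _ _ q →
      shuffleSum S f.1 g.1 (lam R) * algebraMap _ (RatFun R (v₁ + v₂)) (rename (permVar τ) p)
        = algebraMap _ _ (rename (permVar τ) q) := by
    intro τ p q h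
    let j : MvPolynomial (Var (v₁ + v₂)) R →ₐ[R] RatFun R (v₁ + v₂) :=
      (IsScalarTower.toAlgHom _ _ _).comp (rename (permVar τ))
    have hj : Function.Injective j :=
      hinj.comp (rename_injective _ (permVar τ).injective)
    let ψ : RatFun R (v₁ + v₂) →ₐ[R] RatFun R (v₁ + v₂) := IsFractionRing.liftAlgHom hj
    have hψ : ∀ p, ψ (algebraMap _ _ p) = algebraMap _ _ (rename (permVar τ) p) := fun p =>
      IsFractionRing.lift_algebraMap hj p
    have := congrArg ψ h
    rw [map_mul, hψ, hψ, map_shuffleSum] at this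
    rw [← this]
    congr 1
    rw [← shuffleSum_perm S f.2 g.2 (lam R) τ]
    congr 1
    funext a
    simp only [lam, hψ, rename_X]
  have hdvd : vdm R (v₁ + v₂) ∣ Q := by
    apply vdm_dvd
    intro i s t hst
    let τ : ∀ i, Equiv.Perm (Fin ((v₁ + v₂) i)) :=
      Function.update (fun _ => 1) i (Equiv.swap s t)
    have hτi : τ i = Equiv.swap s t := Function.update_self _ _ _
    have hτj : ∀ j, j ≠ i → τ j = 1 := fun j hj => Function.update_of_ne hj _ _
    refine sub_dvd_of_antisymm (τ := permVar τ) ?_ ?_ ?_ ?_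
    · exact congrArg (Sigma.mk i) (by rw [hτi, Equiv.swap_apply_left])
    · exact congrArg (Sigma.mk i) (by rw [hτi, Equiv.swap_apply_right])
    · rintro ⟨j, a⟩ h1 h2
      refine congrArg (Sigma.mk j) ?_
      by_cases hj : j = i
      · subst hj
        rw [hτi, Equiv.swap_apply_of_ne_of_ne]
        · exact fun e => h1 (congrArg (Sigma.mk j) e)
        · exact fun e => h2 (congrArg (Sigma.mk j) e)
      · simp [hτj j hj]
    have hsign : (∏ j, ((Equiv.Perm.sign (τ j) : ℤ) : MvPolynomial (Var (v₁ + v₂)) R)) = -1 := by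
      rw [Finset.prod_eq_single i]
      · simp [hτi, Equiv.Perm.sign_swap hst.ne]
      · intro j _ hj
        simp [hτj j hj]
      · simp
    have h1 := hact τ _ _ hQ
    rw [rename_vdm, hsign, neg_one_mul, map_neg, mul_neg, hQ, ← map_neg] at h1
    have h2 := hinj h1
    exact h2.symm
  obtain ⟨p, hp⟩ := hdvd
  have hv : algebraMap _ (RatFun R (v₁ + v₂)) (vdm R (v₁ + v₂)) ≠ 0 :=
    (map_ne_zero_iff _ hinj).2 (vdm_ne_zero _)
  have hpe : algebraMap _ (RatFun R (v₁ + v₂)) p = shuffleSum S f.1 g.1 (lam R) := by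
    apply mul_right_cancel₀ hv
    rw [hQ, hp, map_mul, mul_comm]
  refine ⟨⟨p, fun τ => ?_⟩, hpe⟩
  have := hact τ 1 p (by rw [map_one, mul_one, hpe])
  rw [map_one, map_one, mul_one, ← hpe] at this
  exact (hinj this).symm

end Polynomiality

/-! ### The sign-twisted shuffle algebra -/

section Product

variable {I : Type*} [Fintype I] {R : Type*} [CommRing R] [IsDomain R] [CharZero R]
variable (S : ShuffleDatum I R) {v₁ v₂ : I → ℕ}

/-- The untwisted shuffle product `f * g`: the symmetric polynomial which, as a rational function,
is `∑_{σ ∈ Sh(v₁,v₂)} σ(f · g · fac₁ · fac₂)`. -/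
def shuffleProduct (f : SHDeg R v₁) (g : SHDeg R v₂) : SHDeg R (v₁ + v₂) :=
  (exists_shuffleProduct S f g).choose

lemma shuffleProduct_spec (f : SHDeg R v₁) (g : SHDeg R v₂) :
    algebraMap _ (RatFun R (v₁ + v₂)) (shuffleProduct S f g).1 = shuffleSum S f.1 g.1 (lam R) :=
  (exists_shuffleProduct S f g).choose_spec

/-- The sign-twisted shuffle product `f ⋆ g = (-1)^{∑_h v₁^{inc h} v₂^{out h}} f * g`. -/
def twistedProduct (f : SHDeg R v₁) (g : SHDeg R v₂) : SHDeg R (v₁ + v₂) :=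
  (-1 : R) ^ signExp S v₁ v₂ • shuffleProduct S f g

lemma shuffleProduct_unique {f : SHDeg R v₁} {g : SHDeg R v₂} {p : SHDeg R (v₁ + v₂)}
    (h : algebraMap _ (RatFun R (v₁ + v₂)) p.1 = shuffleSum S f.1 g.1 (lam R)) :
    shuffleProduct S f g = p :=
  Subtype.ext (IsFractionRing.injective _ (RatFun R (v₁ + v₂))
    ((shuffleProduct_spec S f g).trans h.symm))

/-- The shuffle product evaluated at algebraically independent elements of a field. -/
lemma aeval_shuffleProduct {K : Type*} [Field K] [Algebra R K] (f : SHDeg R v₁) (g : SHDeg R v₂)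
    (x : Var (v₁ + v₂) → K)
    (hx : Function.Injective (aeval x : MvPolynomial (Var (v₁ + v₂)) R →ₐ[R] K)) :
    aeval x (shuffleProduct S f g).1 = shuffleSum S f.1 g.1 x := by
  let ψ : RatFun R (v₁ + v₂) →ₐ[R] K := IsFractionRing.liftAlgHom hx
  have hψ : ∀ p, ψ (algebraMap _ _ p) = aeval x p := fun p => IsFractionRing.lift_algebraMap hx p
  rw [← hψ, shuffleProduct_spec, map_shuffleSum]
  congr 1
  funext a
  simp only [lam, hψ, aeval_X]

lemma shuffleSum_add_left {K : Type*} [Field K] [Algebra R K] (f f' : MvPolynomial (Var v₁) R)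
    (g : MvPolynomial (Var v₂) R) (x : Var (v₁ + v₂) → K) :
    shuffleSum S (f + f') g x = shuffleSum S f g x + shuffleSum S f' g x := by
  simp only [shuffleSum, map_add, add_mul, Finset.sum_add_distrib]

lemma shuffleSum_add_right {K : Type*} [Field K] [Algebra R K] (f : MvPolynomial (Var v₁) R)
    (g g' : MvPolynomial (Var v₂) R) (x : Var (v₁ + v₂) → K) :
    shuffleSum S f (g + g') x = shuffleSum S f g x + shuffleSum S f g' x := by
  simp only [shuffleSum, map_add, add_mul, mul_add, Finset.sum_add_distrib]

lemma shuffleSum_smul_left {K : Type*} [Field K] [Algebra R K] (c : R)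
    (f : MvPolynomial (Var v₁) R) (g : MvPolynomial (Var v₂) R) (x : Var (v₁ + v₂) → K) :
    shuffleSum S (c • f) g x = c • shuffleSum S f g x := by
  simp only [shuffleSum, map_smul, smul_mul_assoc, Finset.smul_sum]

lemma shuffleSum_smul_right {K : Type*} [Field K] [Algebra R K] (c : R)
    (f : MvPolynomial (Var v₁) R) (g : MvPolynomial (Var v₂) R) (x : Var (v₁ + v₂) → K) :
    shuffleSum S f (c • g) x = c • shuffleSum S f g x := by
  simp only [shuffleSum, map_smul, mul_smul_comm, smul_mul_assoc, Finset.smul_sum]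

lemma algebraMap_smul_ratFun {v : I → ℕ} (c : R) (p : MvPolynomial (Var v) R) :
    algebraMap _ (RatFun R v) (c • p) = c • algebraMap _ (RatFun R v) p :=
  map_smul (IsScalarTower.toAlgHom R (MvPolynomial (Var v) R) (RatFun R v)) c p

/-- The sign-twisted shuffle product as a bilinear map. -/
def twistedBilin (v₁ v₂ : I → ℕ) :
    SHDeg R v₁ →ₗ[R] SHDeg R v₂ →ₗ[R] SHDeg R (v₁ + v₂) :=
  LinearMap.mk₂ R (twistedProduct S)
    (fun f f' g => by
      rw [twistedProduct, twistedProduct, twistedProduct, ← smul_add]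
      congr 1
      apply shuffleProduct_unique
      rw [Subalgebra.coe_add, Subalgebra.coe_add, map_add, shuffleSum_add_left,
        shuffleProduct_spec, shuffleProduct_spec])
    (fun c f g => by
      rw [twistedProduct, twistedProduct, smul_comm]
      congr 1
      apply shuffleProduct_unique
      rw [Subalgebra.coe_smul, Subalgebra.coe_smul, algebraMap_smul_ratFun, shuffleSum_smul_left,
        shuffleProduct_spec])
    (fun f g g' => by
      rw [twistedProduct, twistedProduct, twistedProduct, ← smul_add]
      congr 1
      apply shuffleProduct_unique
      rw [Subalgebra.coe_add, Subalgebra.coe_add, map_add, shuffleSum_add_right,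
        shuffleProduct_spec, shuffleProduct_spec])
    (fun c f g => by
      rw [twistedProduct, twistedProduct, smul_comm]
      congr 1
      apply shuffleProduct_unique
      rw [Subalgebra.coe_smul, Subalgebra.coe_smul, algebraMap_smul_ratFun, shuffleSum_smul_right,
        shuffleProduct_spec])

end Product

open DirectSum

/-- The underlying `R`-module `⨁_v SH_v` of the sign-twisted shuffle algebra. -/
def TwistedShuffle {I R : Type*} [CommRing R] (_S : ShuffleDatum I R) : Type _ :=
  ⨁ v : I → ℕ, SHDeg R v

namespace TwistedShuffle

variable {I : Type*} [Fintype I] {R : Type*} [CommRing R]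
variable (S : ShuffleDatum I R) {v v₁ v₂ : I → ℕ}

instance : AddCommGroup (TwistedShuffle S) :=
  inferInstanceAs (AddCommGroup (⨁ v : I → ℕ, SHDeg R v))

instance : Module R (TwistedShuffle S) :=
  inferInstanceAs (Module R (⨁ v : I → ℕ, SHDeg R v))

/-- The inclusion of the degree `v` piece. -/
def of (v : I → ℕ) : SHDeg R v →ₗ[R] TwistedShuffle S :=
  DirectSum.lof R (I → ℕ) (fun v => SHDeg R v) v

/-- The projection to the degree `v` piece. -/
def comp (v : I → ℕ) : TwistedShuffle S →ₗ[R] SHDeg R v :=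
  DirectSum.component R (I → ℕ) (fun v => SHDeg R v) v

/-- The linear map out of the direct sum with given components. -/
def lift {M : Type*} [AddCommGroup M] [Module R M] (φ : ∀ v : I → ℕ, SHDeg R v →ₗ[R] M) :
    TwistedShuffle S →ₗ[R] M :=
  DirectSum.toModule R (I → ℕ) M φ

lemma lift_of {M : Type*} [AddCommGroup M] [Module R M] (φ : ∀ v : I → ℕ, SHDeg R v →ₗ[R] M)
    (f : SHDeg R v) : lift S φ (of S v f) = φ v f := by
  unfold lift of
  exact DirectSum.toModule_lof (R := R) (ι := I → ℕ) (M := fun v => SHDeg R v) (φ := φ) v f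

lemma comp_of_same (f : SHDeg R v) : comp S v (of S v f) = f :=
  DirectSum.of_eq_same (β := fun v : I → ℕ => SHDeg R v) v f

lemma comp_of_ne {w : I → ℕ} (h : w ≠ v) (f : SHDeg R v) : comp S w (of S v f) = 0 :=
  DirectSum.of_eq_of_ne (β := fun v : I → ℕ => SHDeg R v) v w f h

lemma ext_comp {a b : TwistedShuffle S} (h : ∀ v, comp S v a = comp S v b) : a = b :=
  DFinsupp.ext h

lemma induction_on {p : TwistedShuffle S → Prop} (a : TwistedShuffle S) (h0 : p 0)
    (hof : ∀ v f, p (of S v f)) (hadd : ∀ a b, p a → p b → p (a + b)) : p a :=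
  DirectSum.induction_on a h0 hof hadd

section Ambient

/-- The field of rational functions in the variables `λ^i_s`, `i ∈ I`, `s ∈ ℕ`. -/
abbrev AmbField (I R : Type*) [CommRing R] : Type _ := FractionRing (MvPolynomial (I × ℕ) R)

/-- The variable `λ^i_s` of the ambient field. -/
def ambVar (R : Type*) [CommRing R] (i : I) (s : ℕ) : AmbField I R :=
  algebraMap (MvPolynomial (I × ℕ) R) (AmbField I R) (X (i, s))

variable [IsDomain R]

/-- The structure factor of the ambient algebra. -/
def ambFac (A B : I → Finset ℕ) : AmbField I R :=
  (-1) ^ (∑ h : S.quiver.Arrow, (A (S.quiver.inc h)).card * (B (S.quiver.out h)).card) *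
  (∏ i, ∏ s ∈ A i, ∏ t ∈ B i,
    (ambVar R i t - ambVar R i s + algebraMap R (AmbField I R) (S.weight.vertex i * S.t₃)) /
      (ambVar R i t - ambVar R i s)) *
  ∏ h : S.quiver.Arrow,
    ((∏ s ∈ A (S.quiver.out h), ∏ t ∈ B (S.quiver.inc h),
        (ambVar R (S.quiver.inc h) t - ambVar R (S.quiver.out h) s
          + algebraMap R (AmbField I R) (S.weight.arrow h * S.t₁))) *
      ∏ s ∈ A (S.quiver.inc h), ∏ t ∈ B (S.quiver.out h),
        (ambVar R (S.quiver.out h) t - ambVar R (S.quiver.inc h) s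
          + algebraMap R (AmbField I R) (S.weight.opArrow h * S.t₂)))

lemma ambFac_left {A B : I → Finset ℕ} (D : I → Finset ℕ) (h : ∀ i, A i ⊆ B i) :
    ambFac S B D = ambFac S A D * ambFac S (B \ A) D := by
  unfold ambFac
  have hs : (∑ h : S.quiver.Arrow, (B (S.quiver.inc h)).card * (D (S.quiver.out h)).card) =
      (∑ h : S.quiver.Arrow, (A (S.quiver.inc h)).card * (D (S.quiver.out h)).card) +
      ∑ h : S.quiver.Arrow, ((B \ A) (S.quiver.inc h)).card * (D (S.quiver.out h)).card := by
    rw [← Finset.sum_add_distrib]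
    refine Finset.sum_congr rfl fun a _ => ?_
    rw [← add_mul, Pi.sdiff_apply, add_comm, Finset.card_sdiff_add_card_eq_card (h _)]
  have hp : ∀ i (φ : ℕ → AmbField I R), ∏ s ∈ B i, φ s =
      (∏ s ∈ A i, φ s) * ∏ s ∈ (B \ A) i, φ s := by
    intro i φ
    rw [mul_comm, Pi.sdiff_apply, Finset.prod_sdiff (h i)]
  rw [hs, pow_add]
  simp only [hp, Finset.prod_mul_distrib]
  ring

lemma ambFac_right {A B : I → Finset ℕ} (D : I → Finset ℕ) (h : ∀ i, A i ⊆ B i) :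
    ambFac S D B = ambFac S D A * ambFac S D (B \ A) := by
  unfold ambFac
  have hs : (∑ h : S.quiver.Arrow, (D (S.quiver.inc h)).card * (B (S.quiver.out h)).card) =
      (∑ h : S.quiver.Arrow, (D (S.quiver.inc h)).card * (A (S.quiver.out h)).card) +
      ∑ h : S.quiver.Arrow, (D (S.quiver.inc h)).card * ((B \ A) (S.quiver.out h)).card := by
    rw [← Finset.sum_add_distrib]
    refine Finset.sum_congr rfl fun a _ => ?_
    rw [← mul_add, Pi.sdiff_apply, add_comm, Finset.card_sdiff_add_card_eq_card (h _)]
  have hp : ∀ i (φ : ℕ → AmbField I R), ∏ s ∈ B i, φ s =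
      (∏ s ∈ A i, φ s) * ∏ s ∈ (B \ A) i, φ s := by
    intro i φ
    rw [mul_comm, Pi.sdiff_apply, Finset.prod_sdiff (h i)]
  rw [hs, pow_add]
  simp only [hp, Finset.prod_mul_distrib]
  ring

open Classical in
/-- The product of functions on coloured finite sets. -/
def ambMul (F G : (I → Finset ℕ) → AmbField I R) (C : I → Finset ℕ) : AmbField I R :=
  ∑ A ∈ Fintype.piFinset fun i => (C i).powerset, F A * G (C \ A) * ambFac S A (C \ A)

lemma ambMul_assoc (F G H : (I → Finset ℕ) → AmbField I R) :
    ambMul S (ambMul S F G) H = ambMul S F (ambMul S G H) := by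
  classical
  funext C
  unfold ambMul
  simp only [Finset.sum_mul, Finset.mul_sum]
  rw [Finset.sum_sigma', Finset.sum_sigma']
  refine Finset.sum_bij' (fun p _ => ⟨p.2, p.1 \ p.2⟩) (fun p _ => ⟨fun i => p.1 i ∪ p.2 i, p.1⟩)
    ?_ ?_ ?_ ?_ ?_
  · rintro ⟨B, A⟩ h
    simp only [Finset.mem_sigma, Fintype.mem_piFinset, Finset.mem_powerset, Pi.sdiff_apply] at h ⊢
    exact ⟨fun i => (h.2 i).trans (h.1 i), fun i => Finset.sdiff_subset_sdiff (h.1 i) le_rfl⟩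
  · rintro ⟨A, B⟩ h
    simp only [Finset.mem_sigma, Fintype.mem_piFinset, Finset.mem_powerset, Pi.sdiff_apply] at h ⊢
    refine ⟨fun i => Finset.union_subset (h.1 i) ((h.2 i).trans Finset.sdiff_subset), fun i => ?_⟩
    exact Finset.subset_union_left
  · rintro ⟨B, A⟩ h
    simp only [Finset.mem_sigma, Fintype.mem_piFinset, Finset.mem_powerset] at h
    have : (fun i => A i ∪ (B \ A) i) = B := by
      funext i
      exact Finset.union_sdiff_of_subset (h.2 i)
    simp only [this]
  · rintro ⟨A, B⟩ h
    simp only [Finset.mem_sigma, Fintype.mem_piFinset, Finset.mem_powerset, Pi.sdiff_apply] at h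
    have : (fun i => A i ∪ B i) \ A = B := by
      funext i
      ext a
      have := fun ha : a ∈ B i => h.2 i ha
      simp only [Finset.mem_sdiff] at this
      change a ∈ (A i ∪ B i) \ A i ↔ _
      simp only [Finset.mem_sdiff, Finset.mem_union]
      tauto
    simp only [this]
  · rintro ⟨B, A⟩ h
    simp only [Finset.mem_sigma, Fintype.mem_piFinset, Finset.mem_powerset] at h
    have e : (C \ A) \ (B \ A) = C \ B := by
      funext i
      ext a
      change a ∈ (C i \ A i) \ (B i \ A i) ↔ a ∈ C i \ B i
      have := fun ha : a ∈ A i => h.2 i ha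
      simp only [Finset.mem_sdiff]
      tauto
    have h1 := ambFac_left S (C \ B) h.2
    have h2 := ambFac_right S (A := B \ A) (B := C \ A) A
      (fun i => Finset.sdiff_subset_sdiff (h.1 i) le_rfl)
    rw [e] at h2
    simp only [e, h1, h2]
    ring

/-- The embedding of the shuffle algebra into functions on coloured finite sets: a symmetric
polynomial of degree `v` is evaluated at the coloured sets with `v^i` elements of colour `i`. -/
def amb (a : TwistedShuffle S) (A : I → Finset ℕ) : AmbField I R :=
  aeval (fun x : Var (fun i => (A i).card) => ambVar R x.1 ((A x.1).orderEmbOfFin rfl x.2))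
    (comp S (fun i => (A i).card) a).1

lemma amb_add (a b : TwistedShuffle S) : amb S (a + b) = amb S a + amb S b := by
  funext A
  simp only [amb, map_add, Subalgebra.coe_add, Pi.add_apply]

lemma amb_zero : amb S 0 = 0 := by
  funext A
  simp only [amb, map_zero, Subalgebra.coe_zero, Pi.zero_apply]

lemma aeval_amb_injective {v : I → ℕ} (e : ∀ i, Fin (v i) → ℕ)
    (he : ∀ i, Function.Injective (e i)) :
    Function.Injective (aeval (fun x : Var v => ambVar R x.1 (e x.1 x.2)) :
      MvPolynomial (Var v) R →ₐ[R] AmbField I R) := by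
  have h : (aeval (fun x : Var v => ambVar R x.1 (e x.1 x.2)) :
      MvPolynomial (Var v) R →ₐ[R] AmbField I R) =
      (IsScalarTower.toAlgHom R (MvPolynomial (I × ℕ) R) (AmbField I R)).comp
        (rename fun x => (x.1, e x.1 x.2)) := by
    apply MvPolynomial.algHom_ext
    intro x
    simp [ambVar]
  rw [h]
  refine (IsFractionRing.injective (MvPolynomial (I × ℕ) R) (AmbField I R)).comp
    (rename_injective _ ?_)
  rintro ⟨i, s⟩ ⟨j, t⟩ hst
  simp only [Prod.mk.injEq] at hst
  obtain ⟨rfl, hst⟩ := hst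
  exact congrArg _ (he i hst)

lemma amb_injective : Function.Injective (amb S) := by
  intro a b hab
  apply ext_comp
  intro v
  obtain ⟨A, rfl⟩ : ∃ A : I → Finset ℕ, v = fun i => (A i).card :=
    ⟨fun i => Finset.range (v i), by simp⟩
  have h := congrFun hab A
  unfold amb at h
  have hi := aeval_amb_injective (R := R) (fun i => ((A i).orderEmbOfFin rfl : _ → ℕ))
    (fun i => RelEmbedding.injective _)
  exact Subtype.ext (hi h)

lemma amb_of (f : SHDeg R v) (A : I → Finset ℕ) (h : ∀ i, (A i).card = v i) :
    amb S (of S v f) A =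
      aeval (fun x : Var v => ambVar R x.1 ((A x.1).orderEmbOfFin (h x.1) x.2)) f.1 := by
  obtain rfl : v = fun i => (A i).card := funext fun i => (h i).symm
  rw [amb, comp_of_same]

lemma amb_of_ne (f : SHDeg R v) (A : I → Finset ℕ) (h : ¬ ∀ i, (A i).card = v i) :
    amb S (of S v f) A = 0 := by
  rw [amb, comp_of_ne]
  · simp
  · intro e
    exact h (congrFun e)

lemma prod_orderEmb {M : Type*} [CommMonoid M] (A : Finset ℕ) {n : ℕ} (h : A.card = n)
    (φ : ℕ → M) : ∏ s : Fin n, φ (A.orderEmbOfFin h s) = ∏ s ∈ A, φ s := by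
  conv_rhs => rw [← Finset.map_orderEmbOfFin_univ A h, Finset.prod_map]
  rfl

variable [CharZero R]

lemma amb_twistedProduct (f : SHDeg R v₁) (g : SHDeg R v₂) :
    amb S (of S (v₁ + v₂) (twistedProduct S f g)) =
      ambMul S (amb S (of S v₁ f)) (amb S (of S v₂ g)) := by
  classical
  funext C
  by_cases hC : ∀ i, (C i).card = (v₁ + v₂) i
  · have hinj := aeval_amb_injective (R := R) (v := v₁ + v₂)
      (fun i => ((C i).orderEmbOfFin (hC i) : _ → ℕ)) (fun i => RelEmbedding.injective _)
    rw [amb_of S _ C hC, twistedProduct, Subalgebra.coe_smul, map_smul,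
      aeval_shuffleProduct S f g _ hinj, shuffleSum_eq, ambMul, Finset.smul_sum]
    let im : Sub v₁ v₂ → I → Finset ℕ := fun B i =>
      (B.1 i).map ((C i).orderEmbOfFin (hC i)).toEmbedding
    have himc : ∀ B i, (im B i).card = v₁ i := fun B i => by
      rw [Finset.card_map, B.2 i]
    have himsub : ∀ B i, im B i ⊆ C i := fun B i a ha => by
      obtain ⟨b, _, rfl⟩ := Finset.mem_map.1 ha
      exact Finset.orderEmbOfFin_mem _ _ _
    have himd : ∀ B i, ((C \ im B) i).card = v₂ i := fun B i => by
      rw [Pi.sdiff_apply, Finset.card_sdiff_of_subset (himsub B i), hC, himc, Pi.add_apply,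
        Nat.add_sub_cancel_left]
    refine Finset.sum_of_injOn im ?_ ?_ ?_ ?_
    · intro B _ B' _ h
      apply Subtype.ext
      funext i
      exact Finset.map_injective _ (congrFun h i)
    · intro B _
      simp only [Finset.mem_coe, Fintype.mem_piFinset, Finset.mem_powerset]
      exact himsub B
    · intro A hA hA'
      simp only [Fintype.mem_piFinset, Finset.mem_powerset] at hA
      rw [amb_of_ne S f A, zero_mul, zero_mul]
      intro hcard
      apply hA'
      have hpre : ∀ i, ((Finset.univ.filter fun s => (C i).orderEmbOfFin (hC i) s ∈ A i).map
          ((C i).orderEmbOfFin (hC i)).toEmbedding) = A i := by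
        intro i
        ext a
        simp only [Finset.mem_map, Finset.mem_filter, Finset.mem_univ, true_and]
        constructor
        · rintro ⟨s, hs, rfl⟩
          exact hs
        · intro ha
          have : a ∈ Set.range ((C i).orderEmbOfFin (hC i)) := by
            rw [Finset.range_orderEmbOfFin]
            exact hA i ha
          obtain ⟨s, rfl⟩ := this
          exact ⟨s, ha, rfl⟩
      refine ⟨⟨fun i => Finset.univ.filter fun s => (C i).orderEmbOfFin (hC i) s ∈ A i,
        fun i => ?_⟩, Finset.mem_coe.2 (Finset.mem_univ _), funext hpre⟩
      rw [← hcard i]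
      conv_rhs => rw [← hpre i, Finset.card_map]
    · intro B _
      have hl : ∀ a : Var v₁, (C (B.left a).1).orderEmbOfFin (hC _) (B.left a).2 =
          (im B a.1).orderEmbOfFin (himc B a.1) a.2 := by
        rintro ⟨i, s⟩
        refine congrFun (Finset.orderEmbOfFin_unique (himc B i)
          (f := fun s => (C i).orderEmbOfFin (hC i) ((B.1 i).orderEmbOfFin (B.2 i) s))
          (fun s => ?_) ?_) s
        · exact Finset.mem_map_of_mem _ (Finset.orderEmbOfFin_mem _ _ _)
        · exact ((C i).orderEmbOfFin (hC i)).strictMono.comp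
            ((B.1 i).orderEmbOfFin (B.2 i)).strictMono
      have hr : ∀ a : Var v₂, (C (B.right a).1).orderEmbOfFin (hC _) (B.right a).2 =
          ((C \ im B) a.1).orderEmbOfFin (himd B a.1) a.2 := by
        rintro ⟨i, s⟩
        refine congrFun (Finset.orderEmbOfFin_unique (himd B i)
          (f := fun s => (C i).orderEmbOfFin (hC i)
            ((B.1 i)ᶜ.orderEmbOfFin (B.card_compl i) s))
          (fun s => ?_) ?_) s
        · rw [Pi.sdiff_apply, Finset.mem_sdiff]
          refine ⟨Finset.orderEmbOfFin_mem _ _ _, fun hm => ?_⟩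
          obtain ⟨b, hb, e⟩ := Finset.mem_map.1 hm
          have e := RelEmbedding.injective _ e
          have h2 := Finset.orderEmbOfFin_mem (B.1 i)ᶜ (B.card_compl i) s
          rw [← e, Finset.mem_compl] at h2
          exact h2 hb
        · exact ((C i).orderEmbOfFin (hC i)).strictMono.comp
            ((B.1 i)ᶜ.orderEmbOfFin (B.card_compl i)).strictMono
      rw [amb_of S f _ (himc B), amb_of S g _ (himd B)]
      unfold subTerm
      simp only [hl, hr]
      have hl1 : ∀ a, (B.left a).1 = a.1 := fun _ => rfl
      have hr1 : ∀ a, (B.right a).1 = a.1 := fun _ => rfl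
      simp only [hl1, hr1]
      have hf1 : fac₁ S
          (fun a : Var v₁ => ambVar R a.1 ((im B a.1).orderEmbOfFin (himc B a.1) a.2))
          (fun a : Var v₂ => ambVar R a.1 (((C \ im B) a.1).orderEmbOfFin (himd B a.1) a.2)) =
          ∏ i, ∏ s ∈ im B i, ∏ t ∈ (C \ im B) i,
          (ambVar R i t - ambVar R i s + algebraMap R (AmbField I R) (S.weight.vertex i * S.t₃)) /
            (ambVar R i t - ambVar R i s) := by
        unfold fac₁
        refine Finset.prod_congr rfl fun i _ => ?_
        rw [← prod_orderEmb (im B i) (himc B i)]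
        refine Finset.prod_congr rfl fun s _ => ?_
        rw [← prod_orderEmb ((C \ im B) i) (himd B i)]
      have hf2 : fac₂ S
          (fun a : Var v₁ => ambVar R a.1 ((im B a.1).orderEmbOfFin (himc B a.1) a.2))
          (fun a : Var v₂ => ambVar R a.1 (((C \ im B) a.1).orderEmbOfFin (himd B a.1) a.2)) =
          ∏ h : S.quiver.Arrow,
          ((∏ s ∈ im B (S.quiver.out h), ∏ t ∈ (C \ im B) (S.quiver.inc h),
              (ambVar R (S.quiver.inc h) t - ambVar R (S.quiver.out h) s
                + algebraMap R (AmbField I R) (S.weight.arrow h * S.t₁))) *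
            ∏ s ∈ im B (S.quiver.inc h), ∏ t ∈ (C \ im B) (S.quiver.out h),
              (ambVar R (S.quiver.out h) t - ambVar R (S.quiver.inc h) s
                + algebraMap R (AmbField I R) (S.weight.opArrow h * S.t₂))) := by
        unfold fac₂
        refine Finset.prod_congr rfl fun h _ => ?_
        congr 1
        · rw [← prod_orderEmb (im B _) (himc B _)]
          refine Finset.prod_congr rfl fun s _ => ?_
          rw [← prod_orderEmb ((C \ im B) _) (himd B _)]
        · rw [← prod_orderEmb (im B _) (himc B _)]
          refine Finset.prod_congr rfl fun s _ => ?_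
          rw [← prod_orderEmb ((C \ im B) _) (himd B _)]
      rw [hf1, hf2]
      unfold ambFac
      simp only [himc, himd]
      rw [Algebra.smul_def, map_pow, map_neg, map_one, signExp]
      ring
  · rw [amb_of_ne S _ C hC, ambMul]
    symm
    refine Finset.sum_eq_zero fun A hA => ?_
    simp only [Fintype.mem_piFinset, Finset.mem_powerset] at hA
    by_cases h1 : ∀ i, (A i).card = v₁ i
    · rw [amb_of_ne S g, mul_zero, zero_mul]
      intro h2
      apply hC
      intro i
      rw [Pi.add_apply, ← h1 i, ← h2 i, Pi.sdiff_apply, add_comm,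
        Finset.card_sdiff_add_card_eq_card (hA i)]
    · rw [amb_of_ne S f A h1, zero_mul, zero_mul]

end Ambient

variable [IsDomain R] [CharZero R]

/-- The sign-twisted shuffle product `⋆` on `⨁_v SH_v`. -/
def mulHom : TwistedShuffle S →ₗ[R] TwistedShuffle S →ₗ[R] TwistedShuffle S :=
  lift S fun v₁ => LinearMap.flip (lift S fun v₂ =>
    LinearMap.flip ((twistedBilin S v₁ v₂).compr₂ (of S (v₁ + v₂))))

lemma mulHom_of (f : SHDeg R v₁) (g : SHDeg R v₂) :
    mulHom S (of S v₁ f) (of S v₂ g) = of S (v₁ + v₂) (twistedProduct S f g) := by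
  rw [mulHom, lift_of, LinearMap.flip_apply, lift_of]
  rfl

lemma amb_mulHom (a b : TwistedShuffle S) :
    amb S (mulHom S a b) = ambMul S (amb S a) (amb S b) := by
  induction a using induction_on with
  | h0 =>
    rw [map_zero, LinearMap.zero_apply, amb_zero]
    funext C
    simp [ambMul]
  | hadd a a' ha ha' =>
    rw [map_add, LinearMap.add_apply, amb_add, amb_add, ha, ha']
    funext C
    simp [ambMul, add_mul, Finset.sum_add_distrib]
  | hof v f =>
    induction b using induction_on with
    | h0 =>
      rw [map_zero, amb_zero]
      funext C
      simp [ambMul]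
    | hadd b b' hb hb' =>
      rw [map_add, amb_add, amb_add, hb, hb']
      funext C
      simp [ambMul, add_mul, mul_add, Finset.sum_add_distrib]
    | hof w g => rw [mulHom_of, amb_twistedProduct]

lemma amb_one (A : I → Finset ℕ) [Decidable (A = fun _ => ∅)] :
    amb S (of S 0 1) A = if A = (fun _ => ∅) then 1 else 0 := by
  split_ifs with h
  · subst h
    rw [amb_of S (v := 0) 1 (fun _ => ∅) (fun i => rfl)]
    simp
  · apply amb_of_ne
    intro h1
    apply h
    funext i
    exact Finset.card_eq_zero.1 (h1 i)

lemma one_mulHom (a : TwistedShuffle S) : mulHom S (of S 0 1) a = a := by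
  classical
  apply amb_injective S
  rw [amb_mulHom]
  funext C
  rw [ambMul, Finset.sum_eq_single (fun _ => ∅)]
  · have : (C \ fun _ => (∅ : Finset ℕ)) = C := by
      funext i
      exact Finset.sdiff_empty
    rw [amb_one, if_pos rfl, this, one_mul]
    simp [ambFac]
  · intro A _ hA
    rw [amb_one, if_neg hA, zero_mul, zero_mul]
  · intro h
    simp at h

lemma mulHom_one (a : TwistedShuffle S) : mulHom S a (of S 0 1) = a := by
  classical
  apply amb_injective S
  rw [amb_mulHom]
  funext C
  rw [ambMul, Finset.sum_eq_single C]
  · have : C \ C = (fun _ => (∅ : Finset ℕ)) := by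
      funext i
      exact Finset.sdiff_self _
    rw [amb_one, this, if_pos rfl, mul_one]
    simp [ambFac]
  · intro A hA hAC
    rw [amb_one, if_neg, mul_zero, zero_mul]
    intro h
    apply hAC
    simp only [Fintype.mem_piFinset, Finset.mem_powerset] at hA
    funext i
    exact Finset.Subset.antisymm (hA i) (Finset.sdiff_eq_empty_iff_subset.1 (congrFun h i))
  · intro h
    simp at h

/-- The sign-twisted shuffle algebra is an associative unital ring. -/
instance : Ring (TwistedShuffle S) :=
  { (inferInstance : AddCommGroup (TwistedShuffle S)) with
    mul := fun a b => mulHom S a b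
    one := of S 0 1
    mul_assoc := fun a b c => amb_injective S (by
      change amb S (mulHom S (mulHom S a b) c) = amb S (mulHom S a (mulHom S b c))
      rw [amb_mulHom, amb_mulHom, amb_mulHom, amb_mulHom, ambMul_assoc])
    one_mul := one_mulHom S
    mul_one := mulHom_one S
    left_distrib := fun a b c => map_add (mulHom S a) b c
    right_distrib := fun a b c => LinearMap.map_add₂ (mulHom S) a b c
    zero_mul := fun a => LinearMap.map_zero₂ (mulHom S) a
    mul_zero := fun a => map_zero (mulHom S a) }

instance : Algebra R (TwistedShuffle S) :=
  Algebra.ofModule (fun r a b => LinearMap.map_smul₂ (mulHom S) r a b)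
    (fun r a b => map_smul (mulHom S a) r b)

lemma of_mul_of (f : SHDeg R v₁) (g : SHDeg R v₂) :
    of S v₁ f * of S v₂ g = of S (v₁ + v₂) (twistedProduct S f g) :=
  mulHom_of S f g

end TwistedShuffle

namespace TwistedShuffle

/-- The element `(λ^{(k)})^r` of `SH_{e_k} = R[λ^{(k)}]`. -/
def lamPow {I : Type*} [DecidableEq I] (R : Type*) [CommRing R] (k : I) (r : ℕ) :
    SHDeg R (Pi.single k 1 : I → ℕ) :=
  ⟨X ⟨k, ⟨0, by simp⟩⟩ ^ r, fun σ => by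
    have : Subsingleton (Var (Pi.single k 1 : I → ℕ)) := by
      have h : ∀ (i : I) (s : Fin ((Pi.single k 1 : I → ℕ) i)), i = k ∧ s.1 = 0 := by
        intro i s
        by_cases hi : i = k
        · subst hi
          have := s.2.trans_eq (Pi.single_eq_same i 1)
          exact ⟨rfl, by omega⟩
        · have := s.2.trans_eq (Pi.single_eq_of_ne hi 1)
          omega
      refine ⟨?_⟩
      rintro ⟨i, s⟩ ⟨j, t⟩
      obtain ⟨rfl, hs⟩ := h i s
      obtain ⟨rfl, ht⟩ := h j t
      exact congrArg (Sigma.mk j) (Fin.ext (hs.trans ht.symm))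
    rw [map_pow, rename_X]
    congr 2
    exact Subsingleton.elim _ _⟩

/-- A shuffle algebra over `ℂ[ħ]` is in particular a `ℚ[ħ]`-algebra. -/
instance {I : Type*} [Fintype I] (S : ShuffleDatum I (Polynomial ℂ)) :
    Algebra (Polynomial ℚ) (TwistedShuffle S) :=
  Algebra.compHom (TwistedShuffle S) (Polynomial.mapRingHom (algebraMap ℚ ℂ))

end TwistedShuffle

/-! ### Cartan matrices with symmetrizer -/

section Cartan

variable {n : ℕ} (A : Matrix (Fin n) (Fin n) ℤ) (d : Fin n → ℕ)

/-- `A` is a symmetrizable generalized Cartan matrix with symmetrizer `D = diag(d₁, …, dₙ)`. -/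
structure IsCartanWithSymmetrizer : Prop where
  diag : ∀ i, A i i = 2
  nonpos : ∀ i j, i ≠ j → A i j ≤ 0
  ne_zero_iff : ∀ i j, A i j ≠ 0 ↔ A j i ≠ 0
  pos : ∀ i, 0 < d i
  symm : ∀ i j, (d i : ℤ) * A i j = d j * A j i

/-- The quiver with symmetrizer of `(A, D)`: for `i < j` there are `gcd(a_{ij}, a_{ji})` arrows from
`i` to `j`, and `l_{ij} = |a_{ij} / gcd(a_{ij}, a_{ji})|`. -/
def cartanQuiver : QuiverWithSymmetrizer (Fin n) where
  Arrow := Σ p : {p : Fin n × Fin n // p.1 < p.2}, Fin (Int.gcd (A p.1.1 p.1.2) (A p.1.2 p.1.1))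
  out h := h.1.1.1
  inc h := h.1.1.2
  l i j := (A i j / (Int.gcd (A i j) (A j i) : ℤ)).natAbs

/-- The weights `𝐦_i = d_i`, `𝐦_{h_p} = (m + 2 - 2p) e`, `𝐦_{h_p^*} = (-m + 2p) e` where
`h_1, …, h_m` are the arrows from `i` to `j` and `e = 𝐦_i l_{ij} = 𝐦_j l_{ji}`. The arrow `h_p` is
the pair `⟨(i, j), p - 1⟩`. -/
def cartanWeight : WeightFunction (cartanQuiver A) where
  vertex i := d i
  arrow h := ((Int.gcd (A h.1.1.1 h.1.1.2) (A h.1.1.2 h.1.1.1) : ℤ) + 2 - 2 * ((h.2 : ℕ) + 1)) *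
    (d h.1.1.1 * (cartanQuiver A).l h.1.1.1 h.1.1.2)
  opArrow h := (-(Int.gcd (A h.1.1.1 h.1.1.2) (A h.1.1.2 h.1.1.1) : ℤ) + 2 * ((h.2 : ℕ) + 1)) *
    (d h.1.1.1 * (cartanQuiver A).l h.1.1.1 h.1.1.2)

/-- The quiver and weights of `(A, D)` with the specialization `t₁ = t₂ = ħ/2`, `t₃ = -ħ` in
`ℂ[ħ]`. -/
def cartanDatum : ShuffleDatum (Fin n) (Polynomial ℂ) where
  quiver := cartanQuiver A
  weight := cartanWeight A d
  t₁ := Polynomial.C (1 / 2) * Polynomial.X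
  t₂ := Polynomial.C (1 / 2) * Polynomial.X
  t₃ := -Polynomial.X

/-- The sign-twisted shuffle algebra of `(A, D)` specialized at `t₁ = t₂ = ħ/2`, `t₃ = -ħ`. -/
abbrev CartanShuffle : Type := TwistedShuffle (cartanDatum A d)

/-- The generator `x_{k,r}` in the free `ℚ[ħ]`-algebra. -/
def freeGen (n : ℕ) (k : Fin n) (r : ℕ) : FreeAlgebra (Polynomial ℚ) (Fin n × ℕ) :=
  FreeAlgebra.ι (Polynomial ℚ) (k, r)

/-- The scalar `d_k a_{kl} ħ / 2`. -/
def yangianScalar (k l : Fin n) : Polynomial ℚ :=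
  Polynomial.C ((d k * A k l : ℚ) / 2) * Polynomial.X

/-- The defining relations of the positive Yangian, written for the modes `x_{k,r}`: the relation
`quadratic` is the coefficient of `u^{-r-1} v^{-s-1}` of the quadratic relation between the
generating series `∑_r x_{k,r} u^{-r-1}` and `∑_s x_{l,s} v^{-s-1}` (the coefficients of
`u^0 v^{-s-1}` and `u^{-r-1} v^0` of that relation are trivial), and `serre` is the coefficient of
`u_1^{-r_1-1} ⋯ u_N^{-r_N-1} v^{-s-1}`, `N = 1 - a_{kl}`, of the Serre relation. -/
inductive YangianRel : FreeAlgebra (Polynomial ℚ) (Fin n × ℕ) →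
    FreeAlgebra (Polynomial ℚ) (Fin n × ℕ) → Prop
  | quadratic (k l : Fin n) (r s : ℕ) : YangianRel
      (freeGen n k (r + 1) * freeGen n l s - freeGen n k r * freeGen n l (s + 1)
        - yangianScalar A d k l • (freeGen n k r * freeGen n l s))
      (freeGen n l s * freeGen n k (r + 1) - freeGen n l (s + 1) * freeGen n k r
        + yangianScalar A d k l • (freeGen n l s * freeGen n k r))
  | serre (k l : Fin n) (hkl : k ≠ l) (r : Fin (1 - A k l).toNat → ℕ) (s : ℕ) : YangianRel
      (∑ σ : Equiv.Perm (Fin (1 - A k l).toNat),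
        (List.ofFn fun p => freeGen n k (r (σ p))).foldr (fun a b => a * b - b * a)
          (freeGen n l s))
      0

/-- The positive part `Y⁺_ħ(𝔤_{A,D})` of the Yangian, over `ℚ[ħ]`. -/
abbrev PositiveYangian : Type := RingQuot (YangianRel A d)

/-- The generator `x⁺_{k,r}` of the positive Yangian. -/
def PositiveYangian.x (k : Fin n) (r : ℕ) : PositiveYangian A d :=
  RingQuot.mkAlgHom (Polynomial ℚ) (YangianRel A d) (freeGen n k r)

end Cartan

end

end ShuffleYangian

open ShuffleYangian

/-! The map `amb` embeds the shuffle algebra into functions on coloured finite sets, with values in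
one large field of rational functions. There the product is a sum over splittings C = A ⊔ (C \ A),
weighted by the factor `ambFac`, written ω below, which is multiplicative in each argument and
contains the sign twist. The images of the generators are supported on one-point sets, so all
relations reduce to the values of ω on pairs of points.

Quadratic relation. On two-point sets it becomes (λ_k - λ_l - c) ω(k,l) = (λ_k - λ_l + c) ω(l,k)
with c = d_k a_{kl} ħ/2 (`quadratic_of_ambFac`). For k = l this is a direct computation. For k < l
put z = λ_l - λ_k, let m be the number of arrows and ε = e_{kl} ħ/2. Thanks to the sign twist,
ω(k,l) is the product of z + (m - 2p)ε over 0 ≤ p < m, and ω(l,k) is the same product over 1 ≤ p ≤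
m. All but the end factors z ± mε cancel, and mε = -c (`ambFac_quadratic`).

Serre relation. Polarization (`sum_perm_prod_ofFn`) turns the symmetrized nested commutator into a
signed sum of powers ad(x)^N y, where x is a partial sum of the x_{k,r_p} and y = x_{l,s}. Such an x
is again supported on one-point sets of colour k. With η = d_k ħ, the value of ad(x)^n y on n points
of colour k and one of colour l is a product over these points times ∏_{j<n} (j+1)(-2c - jη)
(`amb_iterate_commutator`). The inductive step is a rational function identity from Lagrange
interpolation (`sum_lagrange_difference`). Since -2c = -a_{kl} η, the factor with j = -a_{kl} = N -
1 is zero, so ad(x)^N y = 0. -/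

namespace ShuffleYangian

/-! ### A finite-difference identity by Lagrange interpolation. -/

/-- The leading terms of the second difference `h² n (n - 1) X ^ (n - 2) + ⋯` and of the central
difference `2 h n X ^ (n - 1) + ⋯` of a monic polynomial `∏ t ∈ s, (X - v t)`. -/
lemma coeff_difference_prod_X_sub_C {K ι : Type*} [Field K] (s : Finset ι) (v : ι → K) (h : K) :
    let q := ∏ t ∈ s, (Polynomial.X - Polynomial.C (v t))
    let p := ∏ t ∈ s, (Polynomial.X - Polynomial.C (v t) + Polynomial.C h)
    let r := ∏ t ∈ s, (Polynomial.X - Polynomial.C (v t) - Polynomial.C h)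
    (∀ m, s.card < m → q.coeff m = 0) ∧ q.coeff s.card = 1 ∧
    (∀ m, s.card ≤ m → (p - r).coeff m = 0) ∧
    (∀ m, m + 1 = s.card → (p - r).coeff m = 2 * h * s.card) ∧
    (∀ m, s.card ≤ m + 1 → (p + r - 2 * q).coeff m = 0) ∧
    (∀ m, m + 2 = s.card → (p + r - 2 * q).coeff m = h ^ 2 * s.card * (s.card - 1)) := by
  classical
  induction s using Finset.induction_on with
  | empty =>
    refine ⟨fun m hm => ?_, ?_, fun m _ => ?_, fun m hm => ?_, fun m _ => ?_, fun m hm => ?_⟩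
    · rw [Finset.prod_empty, Polynomial.coeff_one, if_neg]
      simpa [pos_iff_ne_zero] using hm
    · simp
    · simp
    · simp at hm
    · norm_num
    · simp at hm
  | insert a s ha ih =>
    dsimp only at ih ⊢
    rw [Finset.prod_insert ha, Finset.prod_insert ha, Finset.prod_insert ha,
      Finset.card_insert_of_notMem ha]
    set q := ∏ t ∈ s, (Polynomial.X - Polynomial.C (v t))
    set p := ∏ t ∈ s, (Polynomial.X - Polynomial.C (v t) + Polynomial.C h)
    set r := ∏ t ∈ s, (Polynomial.X - Polynomial.C (v t) - Polynomial.C h)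
    obtain ⟨q0, q1, o0, o1, e0, e1⟩ := ih
    set L : Polynomial K := Polynomial.X - Polynomial.C (v a)
    -- A new linear factor L couples the two differences: the central one becomes L times itself
    -- plus h times the second one plus 2hq, and the second one becomes L times itself plus h times
    -- the central one. All coefficient claims follow from these two recursions.
    have hO : (L + Polynomial.C h) * p - (L - Polynomial.C h) * r =
        L * (p - r) + (Polynomial.C h * (p + r - 2 * q) + Polynomial.C (2 * h) * q) := by
      rw [map_mul, map_ofNat]; ring
    have hE : (L + Polynomial.C h) * p + (L - Polynomial.C h) * r - 2 * (L * q) =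
        L * (p + r - 2 * q) + Polynomial.C h * (p - r) := by ring
    have hL : ∀ (f : Polynomial K) m, (L * f).coeff (m + 1) = f.coeff m - v a * f.coeff (m + 1) := by
      intro f m
      rw [sub_mul, Polynomial.coeff_sub, Polynomial.coeff_X_mul, Polynomial.coeff_C_mul]
    have hL0 : ∀ f : Polynomial K, (L * f).coeff 0 = - (v a * f.coeff 0) := by
      intro f
      rw [sub_mul, Polynomial.coeff_sub, Polynomial.coeff_X_mul_zero, Polynomial.coeff_C_mul,
        zero_sub]
    rw [hO, hE]
    refine ⟨fun m hm => ?_, ?_, fun m hm => ?_, fun m hm => ?_, fun m hm => ?_, fun m hm => ?_⟩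
    · obtain ⟨m, rfl⟩ : ∃ j, m = j + 1 := ⟨m - 1, by omega⟩
      rw [hL, q0 m (by omega), q0 (m + 1) (by omega)]; ring
    · rw [hL, q1, q0 _ (by omega)]; ring
    · obtain ⟨m, rfl⟩ : ∃ j, m = j + 1 := ⟨m - 1, by omega⟩
      rw [Polynomial.coeff_add, Polynomial.coeff_add, hL, Polynomial.coeff_C_mul,
        Polynomial.coeff_C_mul, o0 m (by omega), o0 (m + 1) (by omega), e0 _ (by omega),
        q0 _ (by omega)]
      ring
    · obtain rfl : m = s.card := by omega
      rw [Polynomial.coeff_add, Polynomial.coeff_add, Polynomial.coeff_C_mul,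
        Polynomial.coeff_C_mul, q1, e0 _ (by omega)]
      rcases Nat.eq_zero_or_pos s.card with hs | hs
      · rw [hs, hL0, o0 0 (by omega)]
        simp
      · obtain ⟨m, hm'⟩ : ∃ j, s.card = j + 1 := ⟨s.card - 1, by omega⟩
        have h1 := o1 m hm'.symm
        have h2 := o0 (m + 1) hm'.le
        rw [hm', hL, h1, h2, hm']
        push_cast
        ring
    · rcases m with _ | m
      · have hs : s.card = 0 := by omega
        rw [Polynomial.coeff_add, Polynomial.coeff_C_mul, hL0, o0 _ (by omega), e0 _ (by omega)]
        ring
      · rw [Polynomial.coeff_add, Polynomial.coeff_C_mul, hL, o0 _ (by omega), e0 _ (by omega),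
          e0 _ (by omega)]
        ring
    · rw [Polynomial.coeff_add, Polynomial.coeff_C_mul, o1 m (by omega)]
      rcases m with _ | m
      · have hs : s.card = 1 := by omega
        rw [hL0, e0 _ (by omega), hs]
        norm_num
        ring
      · rw [hL, e1 m (by omega), e0 _ (by omega)]
        push_cast
        ring

/-- Up to the factor h, the summands are the Lagrange terms of one polynomial of degree less than
|s|, so the sum is its coefficient of degree |s| - 1. This evaluates the sum over the removed point
in one commutator with a primitive element. -/
lemma sum_lagrange_difference {K ι : Type*} [Field K] [DecidableEq ι] (s : Finset ι) (v : ι → K)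
    (hv : Set.InjOn v s) {h : K} (hh : h ≠ 0) (u M : K) :
    ∑ i ∈ s, ((∏ t ∈ s.erase i, (v i - v t + h) / (v i - v t)) * (u - v i + M) -
      (∏ t ∈ s.erase i, (v i - v t - h) / (v i - v t)) * (u - v i - M)) =
      s.card * (2 * M - (s.card - 1) * h) := by
  obtain ⟨q0, q1, o0, o1, e0, e1⟩ := coeff_difference_prod_X_sub_C s v h
  set q := ∏ t ∈ s, (Polynomial.X - Polynomial.C (v t)) with hq
  set p := ∏ t ∈ s, (Polynomial.X - Polynomial.C (v t) + Polynomial.C h) with hp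
  set r := ∏ t ∈ s, (Polynomial.X - Polynomial.C (v t) - Polynomial.C h) with hr
  rcases s.eq_empty_or_nonempty with rfl | hs
  · simp
  obtain ⟨n, hn⟩ : ∃ n, s.card = n + 1 := ⟨s.card - 1, by have := hs.card_pos; omega⟩
  -- The term -2q does not change the values at the nodes, where q vanishes, but it lowers the
  -- degree of p + r enough for interpolation on s to apply.
  set P : Polynomial K := (Polynomial.C u - Polynomial.X) * (p + r - 2 * q) +
    Polynomial.C M * (p - r) with hP
  have hL : ∀ (f : Polynomial K) m, ((Polynomial.C u - Polynomial.X) * f).coeff (m + 1) =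
      u * f.coeff (m + 1) - f.coeff m := by
    intro f m
    rw [sub_mul, Polynomial.coeff_sub, Polynomial.coeff_X_mul, Polynomial.coeff_C_mul]
  have hdeg : P.degree < s.card := by
    rw [Polynomial.degree_lt_iff_coeff_zero]
    intro m hm
    obtain ⟨m, rfl⟩ : ∃ j, m = j + 1 := ⟨m - 1, by omega⟩
    rw [hP, Polynomial.coeff_add, Polynomial.coeff_C_mul, hL, o0 _ hm, e0 _ (by omega),
      e0 _ (by omega)]
    ring
  have hcoeff : P.coeff (s.card - 1) = h * (s.card * (2 * M - (s.card - 1) * h)) := by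
    rw [hP, Polynomial.coeff_add, Polynomial.coeff_C_mul, o1 _ (by omega), hn, Nat.add_sub_cancel]
    rcases n with _ | n
    · rw [Polynomial.mul_coeff_zero, e0 _ (by omega)]
      push_cast
      ring
    · rw [hL, e0 _ (by omega), e1 _ (by omega), hn]
      push_cast
      ring
  -- At a node v_i, the factor t = i of p equals h and that of r equals -h; hence the extra factor
  -- h.
  apply mul_left_cancel₀ hh
  rw [← hcoeff, Lagrange.coeff_eq_sum hv hdeg, Finset.mul_sum]
  refine Finset.sum_congr rfl fun i hi => ?_
  have h1 : p.eval (v i) = h * ∏ t ∈ s.erase i, (v i - v t + h) := by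
    rw [hp, Polynomial.eval_prod, ← Finset.mul_prod_erase s _ hi]
    simp
  have h2 : r.eval (v i) = -h * ∏ t ∈ s.erase i, (v i - v t - h) := by
    rw [hr, Polynomial.eval_prod, ← Finset.mul_prod_erase s _ hi]
    simp
  have h3 : q.eval (v i) = 0 := by
    rw [hq, Polynomial.eval_prod, ← Finset.mul_prod_erase s _ hi]
    simp
  rw [hP]
  simp only [Polynomial.eval_add, Polynomial.eval_mul, Polynomial.eval_sub, Polynomial.eval_C,
    Polynomial.eval_X, Polynomial.eval_ofNat, h1, h2, h3, Finset.prod_div_distrib]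
  ring

/-! ### Polarization by inclusion-exclusion. -/

/-- Polarization of the `n`-th power in a noncommutative ring. -/
lemma sum_perm_prod_ofFn {A : Type*} [Ring A] {n : ℕ} (a : Fin n → A) :
    ∑ σ : Equiv.Perm (Fin n), (List.ofFn fun i => a (σ i)).prod =
      ∑ T : Finset (Fin n), (-1) ^ T.card * (∑ i ∈ Tᶜ, a i) ^ n := by
  classical
  have h1 : ∀ T : Finset (Fin n), (∑ i ∈ Tᶜ, a i) ^ n =
      ∑ f : Fin n → Fin n, if T ⊆ (Finset.univ.image f)ᶜ then
        (List.ofFn fun i => a (f i)).prod else 0 := by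
    intro T
    have := (MultilinearMap.mkPiAlgebraFin ℤ n A).map_sum_finset (fun _ j => a j) (fun _ => Tᶜ)
    simp only [MultilinearMap.mkPiAlgebraFin_apply, List.ofFn_const, List.prod_replicate] at this
    rw [this, ← Finset.sum_filter]
    refine Finset.sum_congr ?_ fun _ _ => rfl
    ext f
    simp only [Fintype.mem_piFinset, Finset.mem_compl, Finset.mem_filter, Finset.mem_univ, true_and,
      Finset.subset_iff, Finset.mem_image, not_exists]
    constructor
    · rintro h x hx i rfl
      exact h i hx
    · intro h i hi
      exact h hi i rfl
  simp only [h1, Finset.mul_sum]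
  rw [Finset.sum_comm]
  -- The word of f occurs in the T-th power exactly when T avoids the image of f. The alternating
  -- sum over such T vanishes unless the image is everything, so only bijective f survive.
  have h2 : ∀ f : Fin n → Fin n, (∑ T : Finset (Fin n), (-1 : A) ^ T.card *
      if T ⊆ (Finset.univ.image f)ᶜ then (List.ofFn fun i => a (f i)).prod else 0) =
      if Function.Bijective f then (List.ofFn fun i => a (f i)).prod else 0 := by
    intro f
    have h3 := congrArg (Int.cast : ℤ → A)
      (Finset.sum_powerset_neg_one_pow_card (x := (Finset.univ.image f)ᶜ))
    push_cast at h3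
    simp only [mul_ite, mul_zero]
    rw [← Finset.sum_filter, ← Finset.sum_mul]
    have h4 : Finset.univ.filter (fun T => T ⊆ (Finset.univ.image f)ᶜ) =
        (Finset.univ.image f)ᶜ.powerset := by
      ext T; simp
    rw [h4, h3]
    have h5 : (Finset.univ.image f)ᶜ = ∅ ↔ Function.Bijective f := by
      rw [Finset.compl_eq_empty_iff, ← Finite.surjective_iff_bijective]
      simp [Finset.eq_univ_iff_forall, Function.Surjective]
    simp only [h5]
    split_ifs <;> simp
  rw [Finset.sum_congr rfl fun f _ => h2 f, ← Finset.sum_filter]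
  refine Finset.sum_bij (fun σ _ => σ) ?_ ?_ ?_ ?_
  · intro σ _
    exact Finset.mem_filter.2 ⟨Finset.mem_univ _, σ.bijective⟩
  · intro σ _ τ _ h
    exact Equiv.coe_fn_injective h
  · intro f hf
    exact ⟨Equiv.ofBijective f (Finset.mem_filter.1 hf).2, Finset.mem_univ _, rfl⟩
  · intro σ _
    rfl

end ShuffleYangian

/-! ### Elements supported on one-point sets, and the quadratic relation. -/

namespace ShuffleYangian
noncomputable section

namespace TwistedShuffle

variable {I : Type*} [Fintype I] [DecidableEq I] {R : Type*} [CommRing R] [IsDomain R] [CharZero R]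
variable (S : ShuffleDatum I R)

/-- The coloured set with the single element `s` of colour `k`. -/
def pt (k : I) (s : ℕ) : I → Finset ℕ := fun i => if i = k then {s} else ∅

lemma pt_self (k : I) (s : ℕ) : pt k s k = {s} := if_pos rfl

lemma pt_of_ne {i k : I} (h : i ≠ k) (s : ℕ) : pt k s i = ∅ := if_neg h

lemma pt_injective (k : I) : Function.Injective (pt k) := by
  intro s t h
  have := congrFun h k
  rwa [pt_self, pt_self, Finset.singleton_inj] at this

/-- Identifies the coloured sets of degree e_k, which is why the generators are primitive. -/
lemma card_eq_single_iff {k : I} {A : I → Finset ℕ} :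
    (∀ i, (A i).card = (Pi.single k 1 : I → ℕ) i) ↔ ∃ s, A = pt k s := by
  constructor
  · intro h
    obtain ⟨s, hs⟩ := Finset.card_eq_one.1 ((h k).trans (Pi.single_eq_same k 1))
    refine ⟨s, funext fun i => ?_⟩
    by_cases hi : i = k
    · subst hi
      rw [hs, pt_self]
    · rw [pt_of_ne hi, ← Finset.card_eq_zero, h i, Pi.single_eq_of_ne hi]
  · rintro ⟨s, rfl⟩ i
    by_cases hi : i = k
    · subst hi
      rw [pt_self, Pi.single_eq_same, Finset.card_singleton]
    · rw [pt_of_ne hi, Pi.single_eq_of_ne hi, Finset.card_empty]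

/-- The generator `(λ^{(k)})^r` of the shuffle algebra. -/
def gen (k : I) (r : ℕ) : TwistedShuffle S := of S (Pi.single k 1) (lamPow R k r)

lemma amb_gen_pt (k : I) (r s : ℕ) : amb S (gen S k r) (pt k s) = ambVar R k s ^ r := by
  have h := card_eq_single_iff.2 ⟨s, (rfl : pt k s = pt k s)⟩
  rw [gen, amb_of S _ (pt k s) h]
  simp only [lamPow, map_pow, aeval_X]
  have hm : ∀ x ∈ pt k s k, x = s := by simp [pt_self]
  rw [hm _ (Finset.orderEmbOfFin_mem (pt k s k) (h k) ⟨0, by simp⟩)]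

lemma amb_gen_of_ne (k : I) (r : ℕ) {A : I → Finset ℕ} (hA : ∀ s, A ≠ pt k s) :
    amb S (gen S k r) A = 0 := by
  refine amb_of_ne S _ _ fun h => ?_
  obtain ⟨s, hs⟩ := card_eq_single_iff.1 h
  exact hA s hs

lemma amb_mul (a b : TwistedShuffle S) : amb S (a * b) = ambMul S (amb S a) (amb S b) :=
  amb_mulHom S a b

lemma amb_smul (c : R) (a : TwistedShuffle S) : amb S (c • a) = c • amb S a := by
  funext A
  simp only [amb, map_smul, Subalgebra.coe_smul, Pi.smul_apply]

lemma amb_neg (a : TwistedShuffle S) : amb S (-a) = -amb S a := by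
  rw [← neg_one_smul R, amb_smul, neg_one_smul]

lemma amb_sub (a b : TwistedShuffle S) : amb S (a - b) = amb S a - amb S b := by
  rw [sub_eq_add_neg, amb_add, amb_neg, sub_eq_add_neg]

lemma amb_sum {ι : Type*} (s : Finset ι) (a : ι → TwistedShuffle S) :
    amb S (∑ i ∈ s, a i) = ∑ i ∈ s, amb S (a i) := by
  classical
  induction s using Finset.induction_on with
  | empty => exact amb_zero S
  | insert i s hi ih => rw [Finset.sum_insert hi, Finset.sum_insert hi, amb_add, ih]

/-- A function on coloured sets is primitive of colour `k` if it is supported on the one-element sets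
of colour `k`. -/
def IsPrimitive (k : I) (F : (I → Finset ℕ) → AmbField I R) : Prop :=
  ∀ A, (∀ s, A ≠ pt k s) → F A = 0

lemma pt_le_iff {k : I} {s : ℕ} {C : I → Finset ℕ} : (∀ i, pt k s i ⊆ C i) ↔ s ∈ C k := by
  constructor
  · intro h
    exact h k (by rw [pt_self]; exact Finset.mem_singleton_self s)
  · intro h i
    by_cases hi : i = k
    · subst hi
      rw [pt_self]
      exact Finset.singleton_subset_iff.2 h
    · rw [pt_of_ne hi]
      exact Finset.empty_subset _

/-- A primitive left factor sees only splittings that hand it a single point s of colour k, so the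
sum over all subsets collapses to a sum over s. -/
lemma ambMul_left {k : I} {F : (I → Finset ℕ) → AmbField I R} (hF : IsPrimitive k F)
    (G : (I → Finset ℕ) → AmbField I R) (C : I → Finset ℕ) :
    ambMul S F G C =
      ∑ s ∈ C k, F (pt k s) * G (C \ pt k s) * ambFac S (pt k s) (C \ pt k s) := by
  classical
  rw [ambMul]
  symm
  refine Finset.sum_of_injOn (pt k) (pt_injective k).injOn ?_ ?_ (fun _ _ => rfl)
  · intro s hs
    simp only [Finset.mem_coe, Fintype.mem_piFinset, Finset.mem_powerset]
    exact pt_le_iff.2 hs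
  · intro A hA hA'
    rw [hF A, zero_mul, zero_mul]
    rintro s rfl
    simp only [Fintype.mem_piFinset, Finset.mem_powerset] at hA
    exact hA' ⟨s, pt_le_iff.1 hA, rfl⟩

lemma ambMul_right {k : I} {F : (I → Finset ℕ) → AmbField I R} (hF : IsPrimitive k F)
    (G : (I → Finset ℕ) → AmbField I R) (C : I → Finset ℕ) :
    ambMul S G F C =
      ∑ s ∈ C k, F (pt k s) * G (C \ pt k s) * ambFac S (C \ pt k s) (pt k s) := by
  classical
  have hsd : ∀ A : I → Finset ℕ, (∀ i, A i ⊆ C i) → C \ (C \ A) = A := by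
    intro A h
    funext i
    exact Finset.sdiff_sdiff_eq_self (h i)
  rw [ambMul]
  symm
  -- The primitive factor is now on the right, so the subset indexing the splitting is the
  -- complement of the point.
  refine Finset.sum_of_injOn (fun s => C \ pt k s) ?_ ?_ ?_ ?_
  · intro s hs t ht h
    apply pt_injective k
    rw [← hsd _ (pt_le_iff.2 hs), ← hsd _ (pt_le_iff.2 ht)]
    exact congrArg _ h
  · intro s hs
    simp only [Finset.mem_coe, Fintype.mem_piFinset, Finset.mem_powerset]
    exact fun i => Finset.sdiff_subset
  · intro A hA hA'
    simp only [Fintype.mem_piFinset, Finset.mem_powerset] at hA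
    rw [hF (C \ A), mul_zero, zero_mul]
    intro s hs
    refine hA' ⟨s, pt_le_iff.1 fun i => ?_, ?_⟩
    · rw [← hs]
      exact Finset.sdiff_subset
    · dsimp only
      rw [← hs, hsd A hA]
  · intro s hs
    rw [hsd _ (pt_le_iff.2 hs)]
    ring

lemma isPrimitive_gen (k : I) (r : ℕ) : IsPrimitive k (amb S (gen S k r)) :=
  fun _ hA => amb_gen_of_ne S k r hA

/-- The value of the product of two primitive elements. -/
lemma ambMul_primitive {k l : I} {F G : (I → Finset ℕ) → AmbField I R} (hF : IsPrimitive k F)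
    (hG : IsPrimitive l G) (C : I → Finset ℕ) : ambMul S F G C =
    ∑ a ∈ C k, ∑ b ∈ C l, if C \ pt k a = pt l b then
      F (pt k a) * G (pt l b) * ambFac S (pt k a) (pt l b) else 0 := by
  classical
  rw [ambMul_left S hF]
  refine Finset.sum_congr rfl fun a _ => ?_
  by_cases h : ∃ b, C \ pt k a = pt l b
  · obtain ⟨b, hb⟩ := h
    have hbC : b ∈ C l := pt_le_iff.1 fun i => by rw [← hb]; exact Finset.sdiff_subset
    rw [Finset.sum_eq_single b]
    · rw [if_pos hb, hb]
    · intro b' _ hb'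
      rw [if_neg]
      intro h
      exact hb' (pt_injective l (h.symm.trans hb))
    · exact fun h => absurd hbC h
  · rw [hG _ fun b hb => h ⟨b, hb⟩, mul_zero, zero_mul]
    symm
    exact Finset.sum_eq_zero fun b _ => if_neg fun hb => h ⟨b, hb⟩

lemma sdiff_pt_eq_comm {k l : I} {a b : ℕ} {C : I → Finset ℕ} (ha : a ∈ C k)
    (h : C \ pt k a = pt l b) : C \ pt l b = pt k a := by
  rw [← h]
  funext i
  exact Finset.sdiff_sdiff_eq_self (pt_le_iff.2 ha i)

/-- Supplies the distinctness of the two points under which the identity of structure factors is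
available. -/
lemma ne_of_sdiff_pt_eq {k l : I} {a b : ℕ} {C : I → Finset ℕ}
    (h : C \ pt k a = pt l b) : (k, a) ≠ (l, b) := by
  intro e
  obtain ⟨rfl, rfl⟩ := Prod.mk_inj.1 e
  have := congrFun h k
  rw [Pi.sdiff_apply, pt_self] at this
  exact Finset.notMem_sdiff_of_mem_right (Finset.mem_singleton_self a)
    (this.symm ▸ Finset.mem_singleton_self a : a ∈ C k \ {a})

/-- The quadratic relation in a shuffle algebra follows from an identity of the structure
factors. -/
lemma quadratic_of_ambFac {k l : I} {c : R}
    (h : ∀ a b, (k, a) ≠ (l, b) →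
      (ambVar R k a - ambVar R l b - algebraMap R (AmbField I R) c) *
        ambFac S (pt k a) (pt l b) =
      (ambVar R k a - ambVar R l b + algebraMap R (AmbField I R) c) *
        ambFac S (pt l b) (pt k a)) (r s : ℕ) :
    gen S k (r + 1) * gen S l s - gen S k r * gen S l (s + 1) - c • (gen S k r * gen S l s) =
    gen S l s * gen S k (r + 1) - gen S l (s + 1) * gen S k r
      + c • (gen S l s * gen S k r) := by
  classical
  apply amb_injective S
  simp only [amb_sub, amb_add, amb_smul, amb_mul]
  funext C
  simp only [Pi.sub_apply, Pi.add_apply, Pi.smul_apply]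
  simp only [ambMul_primitive S (isPrimitive_gen S k _) (isPrimitive_gen S l _)]
  simp only [ambMul_primitive S (isPrimitive_gen S l _) (isPrimitive_gen S k _),
    Finset.sum_comm (s := C l)]
  simp only [← Finset.sum_sub_distrib, ← Finset.sum_add_distrib, Finset.smul_sum]
  refine Finset.sum_congr rfl fun a ha => Finset.sum_congr rfl fun b hb => ?_
  by_cases e : C \ pt k a = pt l b
  · have e' := sdiff_pt_eq_comm ha e
    simp only [if_pos e, if_pos e', amb_gen_pt, Algebra.smul_def]
    -- The six terms share the monomial λ_k^r λ_l^s; the shifts r + 1 and s + 1 produce the factor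
    -- λ_k - λ_l on both sides.
    linear_combination (ambVar R k a ^ r * ambVar R l b ^ s) * h a b (ne_of_sdiff_pt_eq e)
  · have e' : ¬ C \ pt l b = pt k a := fun e' => e (sdiff_pt_eq_comm hb e')
    simp only [if_neg e, if_neg e', smul_zero, sub_zero, add_zero]

end TwistedShuffle

end
end ShuffleYangian

/-! ### Iterated commutators of primitive elements. -/

namespace ShuffleYangian
noncomputable section

namespace TwistedShuffle

variable {I : Type*} [Fintype I] [DecidableEq I] {R : Type*} [CommRing R] [IsDomain R] [CharZero R]
variable (S : ShuffleDatum I R)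

lemma ambVar_sub_sub_ne_zero {k l : I} {a b : ℕ} (h : (k, a) ≠ (l, b)) (c : R) :
    ambVar R k a - ambVar R l b - algebraMap R (AmbField I R) c ≠ 0 := by
  have e : ambVar R k a - ambVar R l b - algebraMap R (AmbField I R) c =
      algebraMap (MvPolynomial (I × ℕ) R) (AmbField I R) (X (k, a) - X (l, b) - C c) := by
    rw [map_sub, map_sub, ambVar, ambVar, IsScalarTower.algebraMap_apply R
      (MvPolynomial (I × ℕ) R) (AmbField I R), MvPolynomial.algebraMap_eq]
  rw [e, map_ne_zero_iff _ (IsFractionRing.injective _ _)]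
  intro h0
  -- At this point the polynomial takes the value (c + 1) - 0 - c = 1.
  have := congrArg (MvPolynomial.eval (fun i => if i = (k, a) then c + 1 else 0)) h0
  simp only [map_sub, map_zero, eval_X, eval_C, if_neg h.symm, if_true] at this
  simp at this

lemma ambVar_sub_ne_zero {k l : I} {a b : ℕ} (h : (k, a) ≠ (l, b)) :
    ambVar R k a - ambVar R l b ≠ 0 := by
  simpa using ambVar_sub_sub_ne_zero h (0 : R)

lemma ambVar_injective (k : I) : Function.Injective (ambVar R k) := by
  intro a b hab
  by_contra h
  exact ambVar_sub_ne_zero (R := R) (k := k) (l := k) (a := a) (b := b)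
    (fun e => h (Prod.mk_inj.1 e).2) (sub_eq_zero.2 hab)

/-- The coloured set with elements `X` of colour `k` and one element `b` of colour `l ≠ k`. -/
def withPt (k l : I) (X : Finset ℕ) (b : ℕ) : I → Finset ℕ :=
  fun i => if i = k then X else pt l b i

section

variable {k l : I} (hkl : k ≠ l)

lemma withPt_self (X : Finset ℕ) (b : ℕ) : withPt k l X b k = X := if_pos rfl

include hkl

lemma withPt_empty (b : ℕ) : withPt k l ∅ b = pt l b := by
  funext i
  by_cases hi : i = k
  · subst hi
    rw [withPt_self, pt_of_ne hkl]
  · exact if_neg hi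

lemma withPt_ne_pt {X : Finset ℕ} (hX : X ≠ ∅) (b c : ℕ) : withPt k l X b ≠ pt l c := by
  intro h
  have := congrFun h k
  rw [withPt_self, pt_of_ne hkl] at this
  exact hX this

lemma withPt_sdiff_pt (X : Finset ℕ) (b s : ℕ) :
    withPt k l X b \ pt k s = withPt k l (X.erase s) b := by
  funext i
  rw [Pi.sdiff_apply]
  by_cases hi : i = k
  · subst hi
    rw [withPt_self, withPt_self, pt_self, Finset.sdiff_singleton_eq_erase]
  · rw [pt_of_ne hi, Finset.sdiff_empty, withPt, withPt, if_neg hi, if_neg hi]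

/-- The structure factor is multiplicative in its second argument, so the points of colour k can be
peeled off one by one. -/
lemma ambFac_pt_withPt (s b : ℕ) (X : Finset ℕ) :
    ambFac S (pt k s) (withPt k l X b) =
      (∏ t ∈ X, ambFac S (pt k s) (pt k t)) * ambFac S (pt k s) (pt l b) := by
  induction X using Finset.induction_on with
  | empty => rw [withPt_empty hkl, Finset.prod_empty, one_mul]
  | insert t X ht ih =>
    rw [ambFac_right S (A := pt k t) (B := withPt k l (insert t X) b) _
      (pt_le_iff.2 (by rw [withPt_self]; exact Finset.mem_insert_self t X)),
      withPt_sdiff_pt hkl, Finset.erase_insert ht, ih, Finset.prod_insert ht, mul_assoc]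

lemma ambFac_withPt_pt (s b : ℕ) (X : Finset ℕ) :
    ambFac S (withPt k l X b) (pt k s) =
      (∏ t ∈ X, ambFac S (pt k t) (pt k s)) * ambFac S (pt l b) (pt k s) := by
  induction X using Finset.induction_on with
  | empty => rw [withPt_empty hkl, Finset.prod_empty, one_mul]
  | insert t X ht ih =>
    rw [ambFac_left S (A := pt k t) (B := withPt k l (insert t X) b) _
      (pt_le_iff.2 (by rw [withPt_self]; exact Finset.mem_insert_self t X)),
      withPt_sdiff_pt hkl, Finset.erase_insert ht, ih, Finset.prod_insert ht, mul_assoc]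

end

/-- Both products run over the choice of the point taken by x, with the same values of x and y; only
the order of the arguments of the structure factor differs. -/
lemma amb_commutator {k : I} {x : TwistedShuffle S} (hx : IsPrimitive k (amb S x))
    (y : TwistedShuffle S) (C : I → Finset ℕ) :
    amb S (x * y - y * x) C = ∑ s ∈ C k, amb S x (pt k s) * amb S y (C \ pt k s) *
      (ambFac S (pt k s) (C \ pt k s) - ambFac S (C \ pt k s) (pt k s)) := by
  rw [amb_sub, amb_mul, amb_mul, Pi.sub_apply, ambMul_left S hx, ambMul_right S hx,
    ← Finset.sum_sub_distrib]
  exact Finset.sum_congr rfl fun s _ => (mul_sub _ _ _).symm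

/-- The part of C away from colour k is not affected by commutators with primitive elements of
colour k, which keeps the support condition stable under the induction below. -/
lemma update_sdiff_pt (k : I) (s : ℕ) (C : I → Finset ℕ) :
    Function.update (C \ pt k s) k ∅ = Function.update C k ∅ := by
  funext i
  by_cases hi : i = k
  · subst hi
    rw [Function.update_self, Function.update_self]
  · rw [Function.update_of_ne hi, Function.update_of_ne hi, Pi.sdiff_apply, pt_of_ne hi,
      Finset.sdiff_empty]

/-- The iterated commutator of a primitive element of colour `k` with a primitive element of
colour `l` is supported on the coloured sets with one element of colour `l` and all the others of
colour `k`. -/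
lemma amb_iterate_commutator_eq_zero {k l : I} (hkl : k ≠ l) {x y : TwistedShuffle S}
    (hx : IsPrimitive k (amb S x)) (hy : IsPrimitive l (amb S y)) (n : ℕ) {C : I → Finset ℕ}
    (hC : ∀ b, Function.update C k ∅ ≠ pt l b) :
    amb S ((fun z => x * z - z * x)^[n] y) C = 0 := by
  induction n generalizing C with
  | zero =>
    refine hy C fun b hb => hC b ?_
    rw [hb]
    funext i
    by_cases hi : i = k
    · subst hi
      rw [Function.update_self, pt_of_ne hkl]
    · rw [Function.update_of_ne hi]
  | succ n ih =>
    rw [Function.iterate_succ_apply', amb_commutator S hx]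
    refine Finset.sum_eq_zero fun s _ => ?_
    rw [ih, mul_zero, zero_mul]
    rwa [update_sdiff_pt]

section Serre

variable {k l : I} {c η : R}

/-- By `hq`, the factors ω(k,l) and ω(l,k) are u - v_t - c and u - v_t + c times one common
quantity, where u and v_t are the variables of b and t. The product of these quantities and of the
values of x leaves the sum over the removed point; what remains is the sum of
`sum_lagrange_difference` with h = η and M = -c, which contributes (n + 1)(-2c - nη) on n + 1
points. -/
lemma amb_iterate_commutator (hkl : k ≠ l) (hη : η ≠ 0)
    (hkk : ∀ a b, a ≠ b → ambFac S (pt k a) (pt k b) =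
      (ambVar R k a - ambVar R k b + algebraMap R (AmbField I R) η) /
        (ambVar R k a - ambVar R k b))
    (hq : ∀ a b, (ambVar R k a - ambVar R l b - algebraMap R (AmbField I R) c) *
        ambFac S (pt k a) (pt l b) =
      (ambVar R k a - ambVar R l b + algebraMap R (AmbField I R) c) *
        ambFac S (pt l b) (pt k a))
    {x y : TwistedShuffle S}
    (hx : IsPrimitive k (amb S x)) (hy : IsPrimitive l (amb S y)) (n : ℕ) (X : Finset ℕ) (b : ℕ) :
    amb S ((fun z => x * z - z * x)^[n] y) (withPt k l X b) = if X.card = n then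
      (∏ j ∈ Finset.range n, ((j + 1 : AmbField I R) * algebraMap R _ (-2 * c - j * η))) *
      (∏ t ∈ X, amb S x (pt k t) * (ambFac S (pt k t) (pt l b) /
        (ambVar R l b - ambVar R k t - algebraMap R (AmbField I R) c))) * amb S y (pt l b)
      else 0 := by
  induction n generalizing X with
  | zero =>
    split_ifs with hX
    · rw [Finset.card_eq_zero] at hX
      subst hX
      simp [withPt_empty hkl]
    · rw [Finset.card_eq_zero] at hX
      exact hy _ fun c => withPt_ne_pt hkl hX b c
  | succ n ih =>
    rw [Function.iterate_succ_apply', amb_commutator S hx, withPt_self]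
    simp only [withPt_sdiff_pt hkl, ih]
    by_cases hX : X.card = n + 1
    · rw [if_pos hX]
      -- The common part of ω(k,l) and ω(l,k) for the point t; `hT1` and `hT2` recover both factors
      -- from it.
      set T : ℕ → AmbField I R := fun t => ambFac S (pt k t) (pt l b) /
        (ambVar R l b - ambVar R k t - algebraMap R (AmbField I R) c) with hT
      have hne : ∀ t, ambVar R l b - ambVar R k t - algebraMap R (AmbField I R) c ≠ 0 :=
        fun t => ambVar_sub_sub_ne_zero (fun e => hkl (Prod.mk_inj.1 e).1.symm) c
      have hT1 : ∀ t, ambFac S (pt k t) (pt l b) =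
          (ambVar R l b - ambVar R k t + algebraMap R (AmbField I R) (-c)) * T t := by
        intro t
        rw [hT, map_neg, ← sub_eq_add_neg]
        exact (mul_div_cancel₀ _ (hne t)).symm
      have hT2 : ∀ t, ambFac S (pt l b) (pt k t) =
          (ambVar R l b - ambVar R k t - algebraMap R (AmbField I R) (-c)) * T t := by
        intro t
        apply mul_left_cancel₀ (hne t)
        have h1 := hq t b
        rw [hT1 t, map_neg] at h1
        rw [map_neg]
        linear_combination h1
      have key := sum_lagrange_difference X (ambVar R k) (ambVar_injective k).injOn
        (h := algebraMap R (AmbField I R) η)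
        ((map_ne_zero_iff _ (FaithfulSMul.algebraMap_injective R (AmbField I R))).2 hη)
        (ambVar R l b) (algebraMap R (AmbField I R) (-c))
      have step : ∀ s ∈ X, amb S x (pt k s) *
          (if (X.erase s).card = n then
            (∏ j ∈ Finset.range n, ((j + 1 : AmbField I R) * algebraMap R _ (-2 * c - j * η))) *
            (∏ t ∈ X.erase s, amb S x (pt k t) * T t) * amb S y (pt l b) else 0) *
          (ambFac S (pt k s) (withPt k l (X.erase s) b) -
            ambFac S (withPt k l (X.erase s) b) (pt k s)) =
          (∏ j ∈ Finset.range n, ((j + 1 : AmbField I R) * algebraMap R _ (-2 * c - j * η))) *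
            (∏ t ∈ X, amb S x (pt k t) * T t) * amb S y (pt l b) *
          ((∏ t ∈ X.erase s, (ambVar R k s - ambVar R k t + algebraMap R (AmbField I R) η) /
            (ambVar R k s - ambVar R k t)) *
            (ambVar R l b - ambVar R k s + algebraMap R (AmbField I R) (-c)) -
          (∏ t ∈ X.erase s, (ambVar R k s - ambVar R k t - algebraMap R (AmbField I R) η) /
            (ambVar R k s - ambVar R k t)) *
            (ambVar R l b - ambVar R k s - algebraMap R (AmbField I R) (-c))) := by
        intro s hs
        have h1 : ∀ t ∈ X.erase s, ambFac S (pt k s) (pt k t) =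
            (ambVar R k s - ambVar R k t + algebraMap R (AmbField I R) η) /
            (ambVar R k s - ambVar R k t) := fun t ht => hkk s t (Finset.ne_of_mem_erase ht).symm
        have h2 : ∀ t ∈ X.erase s, ambFac S (pt k t) (pt k s) =
            (ambVar R k s - ambVar R k t - algebraMap R (AmbField I R) η) /
            (ambVar R k s - ambVar R k t) := by
          intro t ht
          -- Exchanging the two points of colour k amounts to replacing η by -η.
          rw [hkk t s (Finset.ne_of_mem_erase ht), ← neg_div_neg_eq]
          congr 1 <;> ring
        rw [if_pos (by rw [Finset.card_erase_of_mem hs, hX, Nat.add_sub_cancel]),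
          ambFac_pt_withPt S hkl, ambFac_withPt_pt S hkl, hT1 s, hT2 s, Finset.prod_congr rfl h1,
          Finset.prod_congr rfl h2, ← Finset.mul_prod_erase X _ hs]
        ring
      rw [Finset.sum_congr rfl step, ← Finset.mul_sum, key, Finset.prod_range_succ, hX]
      simp only [map_sub, map_mul, map_neg, map_natCast, map_ofNat]
      push_cast
      ring
    · rw [if_neg hX]
      refine Finset.sum_eq_zero fun s hs => ?_
      rw [if_neg, mul_zero, zero_mul]
      rw [Finset.card_erase_of_mem hs]
      have := Finset.card_pos.2 ⟨s, hs⟩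
      omega

/-- The `N`-fold commutator vanishes if `-2 c = (N - 1) η`. -/
lemma iterate_commutator_eq_zero (hkl : k ≠ l) (hη : η ≠ 0)
    (hkk : ∀ a b, a ≠ b → ambFac S (pt k a) (pt k b) =
      (ambVar R k a - ambVar R k b + algebraMap R (AmbField I R) η) /
        (ambVar R k a - ambVar R k b))
    (hq : ∀ a b, (ambVar R k a - ambVar R l b - algebraMap R (AmbField I R) c) *
        ambFac S (pt k a) (pt l b) =
      (ambVar R k a - ambVar R l b + algebraMap R (AmbField I R) c) *
        ambFac S (pt l b) (pt k a))
    {x y : TwistedShuffle S}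
    (hx : IsPrimitive k (amb S x)) (hy : IsPrimitive l (amb S y)) {m : ℕ} (hm : -2 * c = m * η) :
    (fun z => x * z - z * x)^[m + 1] y = 0 := by
  apply amb_injective S
  rw [amb_zero]
  funext C
  -- Either C consists of points of colour k and one point of colour l, where the closed formula
  -- applies, or it lies outside the support.
  by_cases hC : ∃ b, Function.update C k ∅ = pt l b
  · obtain ⟨b, hb⟩ := hC
    have : C = withPt k l (C k) b := by
      funext i
      by_cases hi : i = k
      · subst hi
        rw [withPt_self]
      · rw [withPt, if_neg hi, ← hb, Function.update_of_ne hi]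
    -- The last factor of the product, j = m, contains -2c - mη, which is zero by `hm`.
    rw [this, amb_iterate_commutator S hkl hη hkk hq hx hy, Finset.prod_range_succ, hm, sub_self,
      map_zero]
    simp
  · exact amb_iterate_commutator_eq_zero S hkl hx hy _ fun b hb => hC ⟨b, hb⟩

lemma isPrimitive_sum {ι : Type*} (s : Finset ι) (x : ι → TwistedShuffle S)
    (hx : ∀ i ∈ s, IsPrimitive k (amb S (x i))) : IsPrimitive k (amb S (∑ i ∈ s, x i)) := by
  intro A hA
  rw [amb_sum, Finset.sum_apply]
  exact Finset.sum_eq_zero fun i hi => hx i hi A hA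

end Serre

end TwistedShuffle

/-- The symmetrized iterated commutator vanishes if all the `n`-th powers of the commutators with
sums of the given elements do. -/
lemma sum_perm_foldr_commutator_eq_zero {A : Type*} [Ring A] {n : ℕ} (a : Fin n → A) (y : A)
    (h : ∀ T : Finset (Fin n),
      (fun z => (∑ i ∈ T, a i) * z - z * ∑ i ∈ T, a i)^[n] y = 0) :
    ∑ σ : Equiv.Perm (Fin n), (List.ofFn fun p => a (σ p)).foldr (fun a b => a * b - b * a) y
      = 0 := by
  -- Nested commutators are words in the operators ad(a_i) applied to y, and ad is additive.
  -- Polarization is therefore used in the endomorphism ring, where the ad(a_i) need not commute.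
  let ad : A →ₗ[ℤ] Module.End ℤ A := LinearMap.mul ℤ A - (LinearMap.mul ℤ A).flip
  have had : ∀ x z, ad x z = x * z - z * x := fun _ _ => rfl
  have h1 : ∀ L : List A, L.foldr (fun a b => a * b - b * a) y = (L.map ad).prod y := by
    intro L
    induction L with
    | nil => rfl
    | cons x L ih =>
      rw [List.foldr_cons, ih, List.map_cons, List.prod_cons, Module.End.mul_apply, had]
  have h2 : ∀ T : Finset (Fin n), ((∑ i ∈ T, ad (a i)) ^ n) y = 0 := by
    intro T
    rw [← map_sum, Module.End.pow_apply]
    exact h T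
  have h3 := congrArg (fun e : Module.End ℤ A => e y) (sum_perm_prod_ofFn fun i => ad (a i))
  simp only [LinearMap.sum_apply] at h3
  simp only [h1, List.map_ofFn]
  refine h3.trans (Finset.sum_eq_zero fun T _ => ?_)
  rw [Module.End.mul_apply, h2, map_zero]

end
end ShuffleYangian

/-! ### Structure factors of pairs of points for a Cartan datum. -/

namespace ShuffleYangian
noncomputable section

namespace TwistedShuffle

section

variable {I : Type*} [Fintype I] [DecidableEq I] {R : Type*} [CommRing R] [IsDomain R]
variable (S : ShuffleDatum I R)

lemma prod_pt {M : Type*} [CommMonoid M] (k i : I) (s : ℕ) (φ : ℕ → M) :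
    ∏ t ∈ pt k s i, φ t = if i = k then φ s else 1 := by
  rw [pt]
  split_ifs <;> simp

lemma card_pt (k i : I) (s : ℕ) : (pt k s i).card = if i = k then 1 else 0 := by
  rw [pt]
  split_ifs <;> simp

/-- Without loops at k, both the sign and the arrow factors are trivial, and only the vertex factor
is left. -/
lemma ambFac_pt_same {k : I} (hk : ∀ h, ¬ (S.quiver.out h = k ∧ S.quiver.inc h = k)) (a b : ℕ) :
    ambFac S (pt k a) (pt k b) = (ambVar R k b - ambVar R k a +
      algebraMap R (AmbField I R) (S.weight.vertex k * S.t₃)) / (ambVar R k b - ambVar R k a) := by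
  unfold ambFac
  rw [Finset.sum_eq_zero, pow_zero, one_mul, Finset.prod_eq_single k,
    Finset.prod_eq_one (s := (Finset.univ : Finset S.quiver.Arrow)), mul_one]
  · simp only [prod_pt, if_true]
  · intro h _
    simp only [prod_pt]
    have := hk h
    split_ifs <;> simp_all
  · intro i _ hi
    rw [prod_pt, if_neg hi]
  · simp
  · intro h _
    simp only [card_pt]
    have := hk h
    split_ifs <;> simp_all

/-- The vertex factors are empty. Each arrow from l to k contributes one sign of the twist, which is
absorbed by negating its linear factor. -/
lemma ambFac_pt_of_ne {k l : I} (hkl : k ≠ l) (a b : ℕ) :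
    ambFac S (pt k a) (pt l b) = ∏ h : S.quiver.Arrow,
      ((if S.quiver.out h = k ∧ S.quiver.inc h = l then
        ambVar R l b - ambVar R k a + algebraMap R (AmbField I R) (S.weight.arrow h * S.t₁)
        else 1) *
      if S.quiver.out h = l ∧ S.quiver.inc h = k then
        ambVar R k a - ambVar R l b - algebraMap R (AmbField I R) (S.weight.opArrow h * S.t₂)
        else 1) := by
  unfold ambFac
  rw [← Finset.prod_pow_eq_pow_sum, Finset.prod_eq_one (s := (Finset.univ : Finset I)), mul_one,
    ← Finset.prod_mul_distrib]
  · refine Finset.prod_congr rfl fun h _ => ?_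
    simp only [prod_pt, card_pt]
    by_cases h1 : S.quiver.out h = k
    · have h2 : S.quiver.out h ≠ l := fun e => hkl (h1.symm.trans e)
      by_cases h3 : S.quiver.inc h = l
      · simp [h1, h3, hkl, hkl.symm]
      · simp [h1, h3, hkl]
    · by_cases h2 : S.quiver.out h = l
      · by_cases h3 : S.quiver.inc h = k
        · simp only [h2, h3, hkl, hkl.symm, if_true, if_false, and_self]
          ring
        · simp [h2, h3, hkl.symm]
      · simp [h1, h2]
  · intro i _
    simp only [prod_pt]
    split_ifs with h1 h2
    · exact absurd (h1.symm.trans h2) hkl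
    · rfl
    · rfl

end

section Cartan

variable {n : ℕ} {A : Matrix (Fin n) (Fin n) ℤ} {d : Fin n → ℕ}

/-- The scalar `d_k a_{kl} ħ / 2` in `ℂ[ħ]`. -/
def halfForm (A : Matrix (Fin n) (Fin n) ℤ) (d : Fin n → ℕ) (k l : Fin n) : Polynomial ℂ :=
  Polynomial.C ((d k * A k l : ℂ) / 2) * Polynomial.X

lemma halfForm_comm (hA : IsCartanWithSymmetrizer A d) (k l : Fin n) :
    halfForm A d k l = halfForm A d l k := by
  have h := congrArg (Int.cast : ℤ → ℂ) (hA.symm k l)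
  push_cast at h
  rw [halfForm, halfForm, h]

lemma cartan_ambFac_pt_same (k : Fin n) (a b : ℕ) :
    ambFac (cartanDatum A d) (pt k a) (pt k b) =
      (ambVar (Polynomial ℂ) k a - ambVar (Polynomial ℂ) k b +
        algebraMap (Polynomial ℂ) _ ((d k : Polynomial ℂ) * Polynomial.X)) /
        (ambVar (Polynomial ℂ) k a - ambVar (Polynomial ℂ) k b) := by
  rw [ambFac_pt_same (cartanDatum A d) (fun (h : (cartanQuiver A).Arrow) hc =>
    h.1.2.ne (hc.1.trans hc.2.symm)), ← neg_div_neg_eq]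
  congr 1
  -- Negating numerator and denominator turns the shift d_k t₃ = -d_k ħ into +d_k ħ.
  · simp only [cartanDatum, cartanWeight, Int.cast_natCast, mul_neg, map_neg]
    ring
  · ring

lemma prod_arrow_eq {k l : Fin n} (hkl : k < l) {M : Type*} [CommMonoid M]
    (φ : (cartanQuiver A).Arrow → M)
    (hφ : ∀ h, ¬ ((cartanQuiver A).out h = k ∧ (cartanQuiver A).inc h = l) → φ h = 1) :
    ∏ h, φ h = ∏ p : Fin (Int.gcd (A k l) (A l k)), φ ⟨⟨(k, l), hkl⟩, p⟩ := by
  refine (Fintype.prod_sigma (fun h => φ h)).trans ?_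
  refine Finset.prod_eq_single (⟨(k, l), hkl⟩ : {p : Fin n × Fin n // p.1 < p.2}) ?_ ?_
  · rintro ⟨⟨i, j⟩, hij⟩ _ hne
    refine Finset.prod_eq_one fun p _ => hφ _ ?_
    rintro ⟨h1, h2⟩
    apply hne
    change i = k at h1
    change j = l at h2
    subst h1 h2
    rfl
  · simp

/-- The number `e_{kl} = d_k |a_{kl} / gcd(a_{kl}, a_{lk})|` times `ħ / 2`. -/
def halfStep (A : Matrix (Fin n) (Fin n) ℤ) (d : Fin n → ℕ) (k l : Fin n) : Polynomial ℂ :=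
  Polynomial.C ((d k * (cartanQuiver A).l k l : ℂ) / 2) * Polynomial.X

/-- Since m l_{kl} = |a_{kl}| = -a_{kl}, the end factors of the telescoping product carry exactly
the shift of the quadratic relation. -/
lemma gcd_mul_halfStep (hA : IsCartanWithSymmetrizer A d) {k l : Fin n} (hkl : k ≠ l) :
    (Int.gcd (A k l) (A l k) : Polynomial ℂ) * halfStep A d k l = -halfForm A d k l := by
  have h1 : (Int.gcd (A k l) (A l k) : ℤ) * ((cartanQuiver A).l k l : ℤ) = -A k l := by
    rw [← abs_of_nonpos (hA.nonpos k l hkl), Int.abs_eq_natAbs]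
    norm_cast
    refine Eq.trans ?_ (congrArg Int.natAbs
      (Int.mul_ediv_cancel' (Int.gcd_dvd_left (A k l) (A l k))))
    rw [Int.natAbs_mul, Int.natAbs_natCast]
    rfl
  have h2 := congrArg (Int.cast : ℤ → ℂ) h1
  push_cast at h2
  rw [halfStep, halfForm, ← mul_assoc, ← neg_mul, ← Polynomial.C_neg,
    ← map_natCast (Polynomial.C : ℂ →+* Polynomial ℂ), ← Polynomial.C_mul]
  congr 2
  linear_combination (d k / 2 : ℂ) * h2

/-- Arrows are numbered from 0 here, so the weight m + 2 - 2(p + 1) of the arrow p is m - 2p in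
units of e_{kl}. -/
lemma ambFac_pt_of_lt {k l : Fin n} (hkl : k < l) (a b : ℕ) :
    ambFac (cartanDatum A d) (pt k a) (pt l b) =
      ∏ p : Fin (Int.gcd (A k l) (A l k)),
        (ambVar (Polynomial ℂ) l b - ambVar (Polynomial ℂ) k a +
          algebraMap (Polynomial ℂ) _
            ((Int.gcd (A k l) (A l k) - 2 * (p : ℕ)) * halfStep A d k l)) := by
  rw [ambFac_pt_of_ne _ hkl.ne]
  have hno : ∀ h : (cartanQuiver A).Arrow,
      ¬ ((cartanQuiver A).out h = l ∧ (cartanQuiver A).inc h = k) := fun h hc =>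
    lt_asymm hkl (hc.1 ▸ hc.2 ▸ (h.1.2 : (cartanQuiver A).out h < (cartanQuiver A).inc h))
  refine (prod_arrow_eq hkl _ fun h hh => ?_).trans (Finset.prod_congr rfl fun p _ => ?_)
  · exact (congrArg₂ (· * ·) (if_neg hh) (if_neg (hno h))).trans (one_mul 1)
  · refine (congrArg₂ (· * ·) (if_pos ⟨rfl, rfl⟩) (if_neg (hno _))).trans ((mul_one _).trans ?_)
    congr 2
    simp only [cartanDatum, cartanWeight, halfStep, div_eq_mul_inv, Polynomial.C_mul,
      Polynomial.C_1, map_natCast]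
    push_cast
    ring

/-- The sign twist negates the weight -m + 2(p + 1) of the opposite arrow. The shifts form the same
arithmetic progression as in `ambFac_pt_of_lt`, moved by one step. -/
lemma ambFac_pt_of_gt {k l : Fin n} (hkl : k < l) (a b : ℕ) :
    ambFac (cartanDatum A d) (pt l b) (pt k a) =
      ∏ p : Fin (Int.gcd (A k l) (A l k)),
        (ambVar (Polynomial ℂ) l b - ambVar (Polynomial ℂ) k a +
          algebraMap (Polynomial ℂ) _
            ((Int.gcd (A k l) (A l k) - 2 * ((p : ℕ) + 1)) * halfStep A d k l)) := by
  rw [ambFac_pt_of_ne _ hkl.ne']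
  have hno : ∀ h : (cartanQuiver A).Arrow,
      ¬ ((cartanQuiver A).out h = l ∧ (cartanQuiver A).inc h = k) := fun h hc =>
    lt_asymm hkl (hc.1 ▸ hc.2 ▸ (h.1.2 : (cartanQuiver A).out h < (cartanQuiver A).inc h))
  refine (prod_arrow_eq hkl _ fun h hh => ?_).trans (Finset.prod_congr rfl fun p _ => ?_)
  · exact (congrArg₂ (· * ·) (if_neg (hno h)) (if_neg hh)).trans (one_mul 1)
  · refine (congrArg₂ (· * ·) (if_neg (hno _)) (if_pos ⟨rfl, rfl⟩)).trans ((one_mul _).trans ?_)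
    rw [sub_eq_add_neg _ (algebraMap _ _ _), ← map_neg]
    congr 2
    simp only [cartanDatum, cartanWeight, halfStep, div_eq_mul_inv, Polynomial.C_mul,
      Polynomial.C_1, map_natCast]
    push_cast
    ring

/-- Both sides are the product of z + (m - 2p)c over 0 ≤ p ≤ m, with the last factor split off on
the left and the first one on the right. -/
lemma telescoping_prod {K : Type*} [CommRing K] (m : ℕ) (z c : K) :
    (z - m * c) * ∏ p : Fin m, (z + (m - 2 * (p : ℕ)) * c) =
      (z + m * c) * ∏ p : Fin m, (z + (m - 2 * ((p : ℕ) + 1)) * c) := by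
  rw [Fin.prod_univ_eq_prod_range (fun p => z + (m - 2 * (p : K)) * c),
    Fin.prod_univ_eq_prod_range (fun p => z + (m - 2 * ((p : K) + 1)) * c)]
  have h1 := Finset.prod_range_succ (fun p : ℕ => z + (m - 2 * (p : K)) * c) m
  have h2 := Finset.prod_range_succ' (fun p : ℕ => z + (m - 2 * (p : K)) * c) m
  push_cast at h2
  linear_combination h2 - h1

lemma ambFac_quadratic_of_lt (hA : IsCartanWithSymmetrizer A d) {k l : Fin n} (hkl : k < l)
    (a b : ℕ) :
    (ambVar (Polynomial ℂ) k a - ambVar (Polynomial ℂ) l b -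
        algebraMap (Polynomial ℂ) _ (halfForm A d k l)) *
        ambFac (cartanDatum A d) (pt k a) (pt l b) =
      (ambVar (Polynomial ℂ) k a - ambVar (Polynomial ℂ) l b +
        algebraMap (Polynomial ℂ) _ (halfForm A d k l)) *
        ambFac (cartanDatum A d) (pt l b) (pt k a) := by
  rw [ambFac_pt_of_lt hkl, ambFac_pt_of_gt hkl,
    ← neg_neg (halfForm A d k l), ← gcd_mul_halfStep hA hkl.ne]
  simp only [map_neg, map_mul, map_sub, map_add, map_natCast, map_ofNat, map_one]
  linear_combination - telescoping_prod (Int.gcd (A k l) (A l k))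
    (ambVar (Polynomial ℂ) l b - ambVar (Polynomial ℂ) k a)
    (algebraMap (Polynomial ℂ) _ (halfStep A d k l))

lemma ambFac_quadratic (hA : IsCartanWithSymmetrizer A d) {k l : Fin n} {a b : ℕ}
    (h : (k, a) ≠ (l, b)) :
    (ambVar (Polynomial ℂ) k a - ambVar (Polynomial ℂ) l b -
        algebraMap (Polynomial ℂ) _ (halfForm A d k l)) *
        ambFac (cartanDatum A d) (pt k a) (pt l b) =
      (ambVar (Polynomial ℂ) k a - ambVar (Polynomial ℂ) l b +
        algebraMap (Polynomial ℂ) _ (halfForm A d k l)) *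
        ambFac (cartanDatum A d) (pt l b) (pt k a) := by
  rcases lt_trichotomy k l with hkl | rfl | hkl
  · exact ambFac_quadratic_of_lt hA hkl a b
  -- As a_{kk} = 2, the shift equals that of the vertex factor, and both sides become (w² - c²)/w
  -- with w the difference of the two variables.
  · have e : halfForm A d k k = (d k : Polynomial ℂ) * Polynomial.X := by
      rw [halfForm, hA.diag, ← map_natCast (Polynomial.C : ℂ →+* Polynomial ℂ)]
      congr 2
      push_cast
      ring
    have h1 := ambVar_sub_ne_zero (R := Polynomial ℂ) h
    have h2 := ambVar_sub_ne_zero (R := Polynomial ℂ) h.symm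
    rw [cartan_ambFac_pt_same, cartan_ambFac_pt_same, e]
    field_simp
    ring
  -- By symmetry of d_k a_{kl}, exchanging the two points only changes the sign of the identity.
  · rw [halfForm_comm hA]
    linear_combination ambFac_quadratic_of_lt hA hkl b a

end Cartan

end TwistedShuffle

/-! ### The homomorphism from the Yangian. -/

section Homomorphism

variable {n : ℕ} {A : Matrix (Fin n) (Fin n) ℤ} {d : Fin n → ℕ}

open TwistedShuffle

/-- The action of ℚ[ħ] is by definition the restriction of that of ℂ[ħ]. -/
lemma yangianScalar_smul (k l : Fin n) (a : CartanShuffle A d) :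
    yangianScalar A d k l • a = halfForm A d k l • a := by
  change (Polynomial.mapRingHom (algebraMap ℚ ℂ)) (yangianScalar A d k l) • a = _
  congr 1
  simp [yangianScalar, halfForm]

lemma gen_serre (hA : IsCartanWithSymmetrizer A d) {k l : Fin n} (hkl : k ≠ l)
    (r : Fin (1 - A k l).toNat → ℕ) (s : ℕ) :
    ∑ σ : Equiv.Perm (Fin (1 - A k l).toNat),
      (List.ofFn fun p => gen (cartanDatum A d) k (r (σ p))).foldr (fun a b => a * b - b * a)
        (gen (cartanDatum A d) l s) = 0 := by
  refine sum_perm_foldr_commutator_eq_zero (fun p => gen (cartanDatum A d) k (r p)) _ fun T => ?_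
  -- With m = -a_{kl} one has N = m + 1 and -2c = -d_k a_{kl} ħ = mη, the vanishing condition of
  -- `iterate_commutator_eq_zero`.
  obtain ⟨m, hm⟩ : ∃ m : ℕ, A k l = -m := ⟨(A k l).natAbs, by have := hA.nonpos k l hkl; omega⟩
  have hN : (1 - A k l).toNat = m + 1 := by omega
  have key := iterate_commutator_eq_zero (cartanDatum A d) (k := k) (l := l)
    (c := halfForm A d k l) (η := (d k : Polynomial ℂ) * Polynomial.X) hkl
    (mul_ne_zero (Nat.cast_ne_zero.2 (hA.pos k).ne') Polynomial.X_ne_zero)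
    (fun a b _ => cartan_ambFac_pt_same k a b)
    (fun a b => ambFac_quadratic hA fun e => hkl (Prod.mk_inj.1 e).1)
    (isPrimitive_sum (cartanDatum A d) T _ fun i _ => isPrimitive_gen _ k (r i))
    (isPrimitive_gen _ l s) (m := m) (by
      rw [halfForm, hm, ← map_natCast (Polynomial.C : ℂ →+* Polynomial ℂ) m,
        ← map_natCast (Polynomial.C : ℂ →+* Polynomial ℂ) (d k),
        ← map_ofNat (Polynomial.C : ℂ →+* Polynomial ℂ) 2, ← Polynomial.C_neg, ← mul_assoc,
        ← mul_assoc, ← Polynomial.C_mul, ← Polynomial.C_mul]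
      congr 2
      push_cast
      ring)
  rw [← hN] at key
  exact key

/-- The homomorphism from the free algebra to the shuffle algebra. -/
def freeToShuffle (A : Matrix (Fin n) (Fin n) ℤ) (d : Fin n → ℕ) :
    FreeAlgebra (Polynomial ℚ) (Fin n × ℕ) →ₐ[Polynomial ℚ] CartanShuffle A d :=
  FreeAlgebra.lift (Polynomial ℚ) fun p => gen (cartanDatum A d) p.1 p.2

lemma freeToShuffle_freeGen (k : Fin n) (r : ℕ) :
    freeToShuffle A d (freeGen n k r) = gen (cartanDatum A d) k r :=
  FreeAlgebra.lift_ι_apply _ _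

lemma freeToShuffle_rel (hA : IsCartanWithSymmetrizer A d)
    {a b : FreeAlgebra (Polynomial ℚ) (Fin n × ℕ)} (h : YangianRel A d a b) :
    freeToShuffle A d a = freeToShuffle A d b := by
  cases h with
  | quadratic k l r s =>
    simp only [map_sub, map_add, map_smul, map_mul, freeToShuffle_freeGen, yangianScalar_smul]
    exact quadratic_of_ambFac _ (fun a b hab => ambFac_quadratic hA hab) r s
  | serre k l hkl r s =>
    have h1 : ∀ L : List (FreeAlgebra (Polynomial ℚ) (Fin n × ℕ)),
        freeToShuffle A d (L.foldr (fun a b => a * b - b * a) (freeGen n l s)) =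
        (L.map (freeToShuffle A d)).foldr (fun a b => a * b - b * a)
          (gen (cartanDatum A d) l s) := by
      intro L
      induction L with
      | nil => exact freeToShuffle_freeGen l s
      | cons x L ih =>
        rw [List.foldr_cons, map_sub, map_mul, map_mul, ih, List.map_cons, List.foldr_cons]
    rw [map_zero, map_sum]
    simp only [h1, List.map_ofFn, Function.comp_def, freeToShuffle_freeGen]
    exact gen_serre hA hkl r s

end Homomorphism

end
end ShuffleYangian

theorem mainTheorem1 (n : ℕ) (A : Matrix (Fin n) (Fin n) ℤ) (d : Fin n → ℕ)
    (hA : IsCartanWithSymmetrizer A d) (hd : Finset.univ.gcd d = 1) :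
    ∃! φ : PositiveYangian A d →ₐ[Polynomial ℚ] CartanShuffle A d,
      ∀ (k : Fin n) (r : ℕ), φ (PositiveYangian.x A d k r) =
        TwistedShuffle.of (cartanDatum A d) (Pi.single k 1)
          (TwistedShuffle.lamPow (Polynomial ℂ) k r) := by
  refine ⟨RingQuot.liftAlgHom (Polynomial ℚ)
    ⟨freeToShuffle A d, fun _ _ h => freeToShuffle_rel hA h⟩, fun k r => ?_, fun ψ hψ => ?_⟩
  · rw [PositiveYangian.x, RingQuot.liftAlgHom_mkAlgHom_apply]
    exact freeToShuffle_freeGen k r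
  -- Uniqueness: the classes of the free generators generate the quotient.
  · apply RingQuot.ringQuot_ext'
    apply FreeAlgebra.hom_ext
    funext p
    have h := hψ p.1 p.2
    simp only [Function.comp_apply, AlgHom.comp_apply, RingQuot.liftAlgHom_mkAlgHom_apply]
    exact h.trans (freeToShuffle_freeGen p.1 p.2).symm
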